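/- Write $\mathbb{R}_*=(0,\infty)$ and $\mathbb{R}_+=[0,\infty)$. For a kernel $K\ge 0$ on $\mathbb{R}_*^2$, a test function $\phi\in C^1_c(\mathbb{R}_+)$ ($C^1$ up to $0$, with $\phi(0)\neq 0$ allowed) and a positive Radon measure $\mu$ on $\mathbb{R}_*$ put $$\langle x\phi,\mathbb{K}[\mu]\rangle=\tfrac12\iint_{\mathbb{R}_*^2}K(x,y)\big((x+y)\phi(x+y)-x\phi(x)-y\phi(y)\big)\,\mu(\mathrm{d}x)\mu(\mathrm{d}y).$$ Take $K\equiv 2$. A *flux solution with zero initial data* is a family $(f_t)_{t\ge0}$ of positive Radon measures on $\mathbb{R}_*$ with $f_0=0$, such that $t\mapsto f_t$ is weak-* continuous (against $C_c(\mathbb{R}_*)$), every $x f_t(\mathrm{d}x)$ is a finite measure, $t\mapsto x f_t$ is weak-* continuous (against $C_0(\mathbb{R}_*)$), and for all $\phi\in C_c^1(\mathbb{R}_+)$ and $t>0$ $$\int_{\mathbb{R}_*}\phi(x)\,x f_t(\mathrm{d}x)=\int_0^t\langle x\phi,\mathbb{K}[f_s]\rangle\,\mathrm{d}s+t\,\phi(0).$$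 A *stationary solution* is a positive Radon measure $\mu$ on $\mathbb{R}_*$ with $\int\min(1,x)\,\mu(\mathrm{d}x)<\infty$ and $-\langle x\phi,\mathbb{K}[\mu]\rangle=\phi(0)$ for all $\phi\in C_c^1(\mathbb{R}_+)$. **Theorem.** There is exactly one flux solution $(f_t)_{t\ge0}$ with zero initial data. It satisfies $\int\min(1,x)f_t(\mathrm{d}x)<\infty$ for all $t\ge 0$, and its Bernstein transform is $$\int_{\mathbb{R}_*}(1-e^{-\lambda x})\,f_t(\mathrm{d}x)=\sqrt\lambda\,\tanh(\sqrt\lambda\,t)\qquad(\lambda>0,\ t\ge0).$$ There is exactly one stationary solution, namely $$\bar f(\mathrm{d}x)=\frac{1}{2\sqrt\pi}\,x^{-3/2}\,\mathrm{d}x,$$ and it has constant flux: $\iint_{\{x\le z,\ y>z-x\}}2x\,\bar f(\mathrm{d}x)\bar f(\mathrm{d}y)=1$ for all $z>0$. As $t\to\infty$, $f_t\to\bar f$ weakly as measures on $\mathbb{R}_*$, i.e. $\int\phi\,\mathrm{d}f_t\to\int\phi\,\mathrm{d}\bar f$ for every $\phi\in C_c(\mathbb{R}_*)$. -/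

import Mathlib

open MeasureTheory Filter Topology
open scoped NNReal ENNReal CompactlySupported ZeroAtInfty

noncomputable section

namespace FluxCoagulation

/-- The space of particle sizes `(0, ∞)`. -/
abbrev Rpos : Type := Set.Ioi (0 : ℝ)

/-- Positive Radon measures on `(0, ∞)`. As `(0, ∞)` is locally compact and second countable,
a Borel measure that is finite on compact sets is automatically regular. -/
def IsRadon (μ : Measure Rpos) : Prop := IsFiniteMeasureOnCompacts μ

/-- The mass measure `x μ(dx)`. -/
def massMeasure (μ : Measure Rpos) : Measure Rpos :=
  μ.withDensity fun x => ENNReal.ofReal (x : ℝ)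

/-- Test functions of class `C¹_c([0, ∞))`: continuously differentiable up to the boundary point
`0` (where they need not vanish), and zero for all large arguments. Only the values of `φ` on
`[0, ∞)` are ever used. -/
def IsTest (φ : ℝ → ℝ) : Prop :=
  ContDiffOn ℝ 1 φ (Set.Ici 0) ∧ ∃ R : ℝ, ∀ x : ℝ, R ≤ x → φ x = 0

/-- The coagulation operator with kernel `K` in weak form, paired with `x φ(x)`:
`½ ∬ K(x,y) ((x+y) φ(x+y) - x φ(x) - y φ(y)) μ(dx) μ(dy)`. -/
def coagForm (K : Rpos → Rpos → ℝ) (φ : ℝ → ℝ) (μ : Measure Rpos) : ℝ :=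
  (1 / 2) * ∫ p : Rpos × Rpos,
    K p.1 p.2 * (((p.1 : ℝ) + p.2) * φ ((p.1 : ℝ) + p.2) - p.1 * φ p.1 - p.2 * φ p.2)
      ∂(μ.prod μ)

/-- The constant kernel `K ≡ 2`. -/
def constKernel : Rpos → Rpos → ℝ := fun _ _ => 2

/-- Solutions, with zero initial data, of the coagulation equation with kernel `K ≡ 2` and a unit
flux of mass from zero. Continuity in time is with respect to the weak-* topologies: against
`C_c(0,∞)` for the Radon measures `f t`, and against `C₀(0,∞)` for the finite measures `x f t`.

For a test function `φ` the integrand of `coagForm` is at most `C x y` in absolute value, with a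
constant `C` that depends on `φ` only, so the double integral converges because `x f t` is finite.
By the uniform boundedness principle the masses are bounded on bounded time intervals, so the
existence of the time integral, written out in `integrable`, is automatic as well. -/
structure IsFluxSolution (f : ℝ≥0 → Measure Rpos) : Prop where
  radon : ∀ t, IsRadon (f t)
  continuous : ∀ φ : C_c(Rpos, ℝ), Continuous fun t => ∫ x, φ x ∂(f t)
  finite_mass : ∀ t, IsFiniteMeasure (massMeasure (f t))
  continuous_mass : ∀ φ : C₀(Rpos, ℝ), Continuous fun t => ∫ x, φ x ∂(massMeasure (f t))
  initial : f 0 = 0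
  integrable : ∀ φ : ℝ → ℝ, IsTest φ → ∀ t : ℝ≥0,
    IntervalIntegrable (fun s : ℝ => coagForm constKernel φ (f s.toNNReal)) volume 0 t
  equation : ∀ φ : ℝ → ℝ, IsTest φ → ∀ t : ℝ≥0, 0 < t →
    ∫ x : Rpos, φ x ∂(massMeasure (f t)) =
      (∫ s in (0 : ℝ)..t, coagForm constKernel φ (f s.toNNReal)) + t * φ 0

/-- Stationary solutions of the coagulation equation with kernel `K ≡ 2` and a unit flux of mass
from zero. The moment condition makes the double integral in `coagForm` converge. -/
structure IsStationarySolution (μ : Measure Rpos) : Prop where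
  radon : IsRadon μ
  moment : Integrable (fun x : Rpos => min 1 (x : ℝ)) μ
  equation : ∀ φ : ℝ → ℝ, IsTest φ → -coagForm constKernel φ μ = φ 0

/-- The Bernstein transform `∫ (1 - e^{-λx}) μ(dx)` at the point `l = λ`. -/
def bernstein (μ : Measure Rpos) (l : ℝ) : ℝ :=
  ∫ x : Rpos, (1 - Real.exp (-l * x)) ∂μ

/-- The mass flux `J_μ(z) = ∬_{x ≤ z < x + y} x K(x,y) μ(dx) μ(dy)`, for a nonnegative kernel. -/
def massFlux (K : Rpos → Rpos → ℝ) (μ : Measure Rpos) (z : ℝ) : ℝ≥0∞ :=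
  ∫⁻ p in {p : Rpos × Rpos | (p.1 : ℝ) ≤ z ∧ z - p.1 < p.2},
    ENNReal.ofReal (p.1 * K p.1 p.2) ∂(μ.prod μ)

/-- The power law `c x^{-3/2} dx` on `(0, ∞)`. -/
def powerLaw (c : ℝ) : Measure Rpos :=
  ((volume : Measure ℝ).comap Subtype.val).withDensity fun x : Rpos =>
    ENNReal.ofReal (c * (x : ℝ) ^ (-(3 / 2) : ℝ))

end FluxCoagulation

end

open MeasureTheory Filter Topology
open scoped NNReal ENNReal CompactlySupported ZeroAtInfty

noncomputable section

namespace FluxCoagulation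

/-! Everything is read off from the Bernstein transform B(λ) = ∫ (1 - e^{-λx}) μ(dx), whose
derivative is the Laplace transform of x μ(dx). For the kernel 2 and φ(x) = e^{-λx} the coagulation
form factorises as -2 B B' = -(B²)' (`coagForm_exp`). A stationary solution therefore satisfies
(B²)' = 1 with B(0+) = 0 and B ≥ 0, so B = √λ. For a flux solution, integrating B_t' = t - ∫₀ᵗ
(B_s²)' ds in λ gives the Riccati equation ∂_t B = λ - B² with B_0 = 0, whose only nonnegative
solution is √λ tanh(√λ t). Since B determines the measure (`HasMoment.ext_of_bernstein`), both
uniqueness claims follow. Since tanh → 1 and pointwise convergence of B implies convergence against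
C_c, so does the long-time limit.

Exponentials are not compactly supported, so they have to be exchanged with test functions. The norm
that does this is sup (1+x)|r| together with sup (1+x)|r'| (`DecayBound`): it controls the form by
(∫ min(1,x) dμ)². In it, exponentials are limits of truncated exponentials (`exists_test_near_exp`),
which serves uniqueness, and test functions are limits of exponential sums by Weierstrass in the
variable e^{-x} (`IsTest.exists_expSum_near`), which serves existence. The a priori bound "mass at
time t is at most t" makes the errors uniform on bounded time intervals.

For existence no inversion theorem is needed: the partial fractions of tanh write √λ tanh(√λ t) as a
series of terms λ/(λ+a), each the Bernstein transform of an exponential law of rate a. The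
stationary power law is identified by Γ(1/2) = √π, and its flux is an arcsine integral. -/

/-- The condition `∫ min(1, x) μ(dx) < ∞`. -/
abbrev HasMoment (μ : Measure Rpos) : Prop := Integrable (fun x : Rpos => min 1 (x : ℝ)) μ

/-- The derivative `∫ x e^{-λx} μ(dx)` of the Bernstein transform at `l = λ`. -/
def massLaplace (μ : Measure Rpos) (l : ℝ) : ℝ :=
  ∫ x : Rpos, (x : ℝ) * Real.exp (-l * x) ∂μ

/-! ### Bernstein transforms of measures that integrate min(1, x) -/

lemma Rpos.pos (x : Rpos) : 0 < (x : ℝ) := x.2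

lemma min_one_pos (x : Rpos) : 0 < min 1 (x : ℝ) := lt_min one_pos x.pos

lemma one_sub_exp_nonneg {l x : ℝ} (hl : 0 ≤ l) (hx : 0 ≤ x) : 0 ≤ 1 - Real.exp (-l * x) := by
  have : Real.exp (-l * x) ≤ 1 := Real.exp_le_one_iff.2 (by nlinarith)
  linarith

lemma one_sub_exp_le_mul (l x : ℝ) : 1 - Real.exp (-l * x) ≤ l * x := by
  have := Real.add_one_le_exp (-l * x)
  linarith

lemma one_sub_exp_le_min {l x : ℝ} (hl : 0 ≤ l) (hx : 0 ≤ x) :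
    1 - Real.exp (-l * x) ≤ (1 + l) * min 1 x := by
  have h1 := one_sub_exp_le_mul l x
  have h2 := Real.exp_pos (-l * x)
  rcases le_total 1 x with h | h
  · rw [min_eq_left h]; linarith
  · rw [min_eq_right h]; linarith

lemma mul_exp_neg_le {l : ℝ} (hl : 0 < l) (x : ℝ) : x * Real.exp (-l * x) ≤ 1 / l := by
  rw [le_div_iff₀ hl]
  have h1 := Real.add_one_le_exp (l * x)
  have h2 : Real.exp (l * x) * Real.exp (-l * x) = 1 := by rw [← Real.exp_add]; simp
  have h3 := Real.exp_pos (-l * x)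
  nlinarith

lemma mul_exp_neg_le_min {l x : ℝ} (hl : 0 < l) (hx : 0 ≤ x) :
    x * Real.exp (-l * x) ≤ (1 + 1 / l) * min 1 x := by
  have h1 := mul_exp_neg_le hl x
  have h2 : Real.exp (-l * x) ≤ 1 := Real.exp_le_one_iff.2 (by nlinarith)
  have h3 : 0 < 1 / l := by positivity
  rcases le_total 1 x with h | h
  · rw [min_eq_left h]; linarith
  · rw [min_eq_right h]; nlinarith

lemma HasMoment.integrable_of_le {μ : Measure Rpos} (hμ : HasMoment μ) {h : Rpos → ℝ}
    (hm : Measurable h) {C : ℝ} (hC : ∀ x, |h x| ≤ C * min 1 (x : ℝ)) : Integrable h μ :=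
  (hμ.const_mul C).mono' hm.aestronglyMeasurable (Eventually.of_forall hC)

lemma HasMoment.integrable_one_sub_exp {μ : Measure Rpos} (hμ : HasMoment μ) {l : ℝ}
    (hl : 0 ≤ l) : Integrable (fun x : Rpos => 1 - Real.exp (-l * x)) μ := by
  refine hμ.integrable_of_le (by fun_prop) (C := 1 + l) fun x => ?_
  rw [abs_of_nonneg (one_sub_exp_nonneg hl x.pos.le)]
  exact one_sub_exp_le_min hl x.pos.le

lemma HasMoment.integrable_mul_exp {μ : Measure Rpos} (hμ : HasMoment μ) {l : ℝ}
    (hl : 0 < l) : Integrable (fun x : Rpos => (x : ℝ) * Real.exp (-l * x)) μ := by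
  refine hμ.integrable_of_le (by fun_prop) (C := 1 + 1 / l) fun x => ?_
  have := x.pos
  rw [abs_of_nonneg (by positivity)]
  exact mul_exp_neg_le_min hl x.pos.le

lemma bernstein_nonneg {μ : Measure Rpos} {l : ℝ} (hl : 0 ≤ l) : 0 ≤ bernstein μ l :=
  integral_nonneg fun x => one_sub_exp_nonneg hl x.pos.le

lemma massLaplace_nonneg (μ : Measure Rpos) (l : ℝ) : 0 ≤ massLaplace μ l :=
  integral_nonneg fun x => mul_nonneg x.pos.le (Real.exp_pos _).le

lemma HasMoment.hasDerivAt_bernstein {μ : Measure Rpos} (hμ : HasMoment μ) {l : ℝ}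
    (hl : 0 < l) : HasDerivAt (bernstein μ) (massLaplace μ l) l := by
  refine (hasDerivAt_integral_of_dominated_loc_of_deriv_le
    (F := fun (l : ℝ) (x : Rpos) => 1 - Real.exp (-l * x))
    (F' := fun (l : ℝ) (x : Rpos) => (x : ℝ) * Real.exp (-l * x))
    -- On the neighbourhood (l/2, ∞) of l, the derivative x e^{-kx} is largest at the left end.
    (bound := fun x : Rpos => (x : ℝ) * Real.exp (-(l / 2) * x))
    (Ioi_mem_nhds (half_lt_self hl)) (Eventually.of_forall fun l => ?_)
    (hμ.integrable_one_sub_exp hl.le) (hμ.integrable_mul_exp hl).aestronglyMeasurable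
    (Eventually.of_forall fun x k hk => ?_) (hμ.integrable_mul_exp (half_pos hl))
    (Eventually.of_forall fun x k _ => ?_)).2
  · exact (by fun_prop : Measurable fun x : Rpos => 1 - Real.exp (-l * x)).aestronglyMeasurable
  · have := x.pos
    rw [Real.norm_of_nonneg (by positivity)]
    gcongr
    exact hk.le
  · have h : HasDerivAt (fun k : ℝ => -k * (x : ℝ)) (-1 * (x : ℝ)) k :=
      (hasDerivAt_id k).neg.mul_const _
    convert h.exp.const_sub 1 using 1
    ring

/-- This fixes the constant of integration whenever an identity between derivatives in λ is
integrated. -/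
lemma HasMoment.tendsto_bernstein_zero {μ : Measure Rpos} (hμ : HasMoment μ) :
    Tendsto (bernstein μ) (𝓝[>] 0) (𝓝 0) := by
  have h : Tendsto (bernstein μ) (𝓝[>] 0) (𝓝 (∫ _ : Rpos, (0 : ℝ) ∂μ)) := by
    refine tendsto_integral_filter_of_dominated_convergence
      (fun x : Rpos => 2 * min 1 (x : ℝ)) (Eventually.of_forall fun l => ?_) ?_
      (hμ.const_mul 2) (Eventually.of_forall fun x => ?_)
    · exact (by fun_prop : Measurable fun x : Rpos => 1 - Real.exp (-l * x)).aestronglyMeasurable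
    · filter_upwards [Ioo_mem_nhdsGT (zero_lt_one' ℝ)] with l hl
      refine Eventually.of_forall fun x => ?_
      rw [Real.norm_of_nonneg (one_sub_exp_nonneg hl.1.le x.pos.le)]
      refine (one_sub_exp_le_min hl.1.le x.pos.le).trans ?_
      have := (min_one_pos x).le
      gcongr
      linarith [hl.2]
    · have : Continuous fun l : ℝ => 1 - Real.exp (-l * x) := by fun_prop
      simpa using (this.tendsto 0).mono_left nhdsWithin_le_nhds
  simpa using h

/-- A function on `(0, ∞)` with vanishing derivative and limit `0` at `0` vanishes. -/
lemma eq_zero_of_deriv_eq_zero_of_tendsto {W : ℝ → ℝ} (hW : ∀ l, 0 < l → HasDerivAt W 0 l)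
    (h0 : Tendsto W (𝓝[>] 0) (𝓝 0)) {l : ℝ} (hl : 0 < l) : W l = 0 := by
  have hc : ∀ k ∈ Set.Ioi (0 : ℝ), W k = W l := fun k hk =>
    isOpen_Ioi.is_const_of_deriv_eq_zero (convex_Ioi (0 : ℝ)).isPreconnected
      (fun x hx => (hW x hx).differentiableAt.differentiableWithinAt)
      (fun x hx => (hW x hx).deriv) hk hl
  refine tendsto_nhds_unique (tendsto_const_nhds.congr' ?_) h0
  filter_upwards [self_mem_nhdsWithin] with k hk using (hc k hk).symm

/-- On a compact set min(1, x) has a positive minimum, so Markov's inequality applies. -/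
lemma HasMoment.isFiniteMeasureOnCompacts {μ : Measure Rpos} (hμ : HasMoment μ) :
    IsFiniteMeasureOnCompacts μ where
  lt_top_of_isCompact K hK := by
    rcases K.eq_empty_or_nonempty with rfl | hne
    · simp
    obtain ⟨x₀, -, hx₀⟩ := hK.exists_isMinOn hne
      (f := fun x : Rpos => min 1 (x : ℝ)) (by fun_prop)
    refine (measure_mono fun x hx => ?_).trans_lt
      (hμ.measure_ge_lt_top (min_one_pos x₀))
    exact hx₀ hx

instance : LocallyCompactSpace Rpos := isOpen_Ioi.locallyCompactSpace

lemma HasMoment.sigmaFinite {μ : Measure Rpos} (hμ : HasMoment μ) : SigmaFinite μ := by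
  have := hμ.isFiniteMeasureOnCompacts
  have := isLocallyFiniteMeasure_of_isFiniteMeasureOnCompacts (μ := μ)
  infer_instance

/-! ### The coagulation form on decaying C¹ functions -/

/-- The expression `(x + y) φ(x + y) - x φ(x) - y φ(y)`. -/
def defect (φ : ℝ → ℝ) (x y : ℝ) : ℝ := (x + y) * φ (x + y) - x * φ x - y * φ y

lemma coagForm_constKernel (φ : ℝ → ℝ) (μ : Measure Rpos) :
    coagForm constKernel φ μ = ∫ p : Rpos × Rpos, defect φ p.1 p.2 ∂(μ.prod μ) := by
  unfold coagForm constKernel defect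
  rw [integral_const_mul]
  ring

/-- `r` is differentiable on `[0, ∞)` with derivative `r'`, and both are at most `C / (1 + x)`. -/
def DecayBound (C : ℝ) (r r' : ℝ → ℝ) : Prop :=
  ∀ x, 0 ≤ x → HasDerivWithinAt r (r' x) (Set.Ici 0) x ∧
    (1 + x) * |r x| ≤ C ∧ (1 + x) * |r' x| ≤ C

namespace DecayBound

variable {C C₁ C₂ : ℝ} {r r' s s' : ℝ → ℝ}

lemma nonneg (h : DecayBound C r r') : 0 ≤ C := by
  have := (h 0 le_rfl).2.1
  have := abs_nonneg (r 0)
  linarith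

lemma abs_le (h : DecayBound C r r') {x : ℝ} (hx : 0 ≤ x) : |r x| ≤ C := by
  have := (h x hx).2.1
  have := abs_nonneg (r x)
  nlinarith

lemma abs_deriv_le (h : DecayBound C r r') {x : ℝ} (hx : 0 ≤ x) : |r' x| ≤ C := by
  have := (h x hx).2.2
  have := abs_nonneg (r' x)
  nlinarith

lemma abs_mul_le (h : DecayBound C r r') {x : ℝ} (hx : 0 ≤ x) : |x * r x| ≤ C := by
  have := (h x hx).2.1
  have := abs_nonneg (r x)
  rw [abs_mul, abs_of_nonneg hx]
  nlinarith

lemma continuousOn (h : DecayBound C r r') : ContinuousOn r (Set.Ici 0) :=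
  fun x hx => (h x hx).1.continuousWithinAt

lemma sub (h : DecayBound C₁ r r') (k : DecayBound C₂ s s') :
    DecayBound (C₁ + C₂) (r - s) (r' - s') := fun x hx => by
  refine ⟨(h x hx).1.sub (k x hx).1, ?_, ?_⟩
  · have := (h x hx).2.1
    have := (k x hx).2.1
    have : |r x - s x| ≤ |r x| + |s x| := abs_sub _ _
    simp only [Pi.sub_apply]
    nlinarith
  · have := (h x hx).2.2
    have := (k x hx).2.2
    have : |r' x - s' x| ≤ |r' x| + |s' x| := abs_sub _ _
    simp only [Pi.sub_apply]
    nlinarith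

lemma abs_sub_le (h : DecayBound C r r') {x y : ℝ} (hx : 0 ≤ x) (hy : 0 ≤ y) :
    |r y - r x| ≤ C * |y - x| :=
  (convex_Ici (0 : ℝ)).norm_image_sub_le_of_norm_hasDerivWithin_le (fun z hz => (h z hz).1)
    (fun _ hz => h.abs_deriv_le hz) hx hy

lemma abs_mul_sub_le (h : DecayBound C r r') {x y : ℝ} (hx : 0 ≤ x) (hy : 0 ≤ y) :
    |y * r y - x * r x| ≤ C * |y - x| := by
  refine (convex_Ici (0 : ℝ)).norm_image_sub_le_of_norm_hasDerivWithin_le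
    (f := fun z => z * r z) (f' := fun z => 1 * r z + z * r' z)
    (fun z hz => (hasDerivWithinAt_id z _).mul (h z hz).1) (fun z hz => ?_) hx hy
  have hz : 0 ≤ z := hz
  have h1 := (h z hz).2.1
  have h2 := (h z hz).2.2
  have h3 : |1 * r z + z * r' z| ≤ |r z| + z * |r' z| := by
    refine (abs_add_le _ _).trans (le_of_eq ?_)
    rw [one_mul, abs_mul, abs_of_nonneg hz]
  -- Multiplied by 1 + z, the bound reads C + z C, so no constant is lost.
  refine h3.trans (le_of_mul_le_mul_left ?_ (by linarith : 0 < 1 + z))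
  nlinarith

/-- Three regimes. If both sizes exceed 1, each term z r(z) is bounded by C. If one is small, the
Lipschitz bound for z r(z) gives a factor of that size. If both are small, writing the defect as x
(r(x+y) - r(x)) + y (r(x+y) - r(y)) gives the product xy. -/
lemma abs_defect_le (h : DecayBound C r r') {x y : ℝ} (hx : 0 ≤ x) (hy : 0 ≤ y) :
    |defect r x y| ≤ 3 * C * (min 1 x * min 1 y) := by
  have hC := h.nonneg
  have hxy : 0 ≤ x + y := by linarith
  have hone {x y : ℝ} (hx : 0 ≤ x) (hy : 0 ≤ y) (h1 : x ≤ 1) :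
      |(x + y) * r (x + y) - x * r x - y * r y| ≤ 3 * C * x := by
    have a1 := h.abs_mul_sub_le hy (add_nonneg hx hy)
    rw [show x + y - y = x by ring, abs_of_nonneg hx] at a1
    have a2 : |x * r x| ≤ C * x := by
      rw [abs_mul, abs_of_nonneg hx, mul_comm]
      exact mul_le_mul_of_nonneg_right (h.abs_le hx) hx
    rw [_root_.abs_le] at a1 a2 ⊢
    constructor <;> nlinarith
  unfold defect
  rcases le_total 1 x with h1 | h1 <;> rcases le_total 1 y with h2 | h2
  · rw [min_eq_left h1, min_eq_left h2]
    have a1 := h.abs_mul_le hx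
    have a2 := h.abs_mul_le hy
    have a3 := h.abs_mul_le hxy
    rw [_root_.abs_le] at a1 a2 a3 ⊢
    constructor <;> linarith
  · rw [min_eq_left h1, min_eq_right h2, one_mul]
    have := hone hy hx h2
    rwa [add_comm y x, sub_right_comm] at this
  · rw [min_eq_left h2, min_eq_right h1, mul_one]
    exact hone hx hy h1
  · rw [min_eq_right h1, min_eq_right h2]
    have a1 := h.abs_sub_le hx hxy
    have a2 := h.abs_sub_le hy hxy
    rw [show x + y - x = y by ring, abs_of_nonneg hy] at a1
    rw [show x + y - y = x by ring, abs_of_nonneg hx] at a2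
    rw [show (x + y) * r (x + y) - x * r x - y * r y =
      x * (r (x + y) - r x) + y * (r (x + y) - r y) by ring]
    refine (abs_add_le _ _).trans ?_
    rw [abs_mul, abs_mul, abs_of_nonneg hx, abs_of_nonneg hy]
    have b1 := mul_le_mul_of_nonneg_left a1 hx
    have b2 := mul_le_mul_of_nonneg_left a2 hy
    have b3 : 0 ≤ C * (x * y) := by positivity
    nlinarith

lemma measurable (h : DecayBound C r r') : Measurable fun x : Rpos => r x :=
  (h.continuousOn.comp_continuous (f := fun x : Rpos => (x : ℝ)) (by fun_prop)
    fun x => x.pos.le).measurable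

lemma measurable_defect (h : DecayBound C r r') :
    Measurable fun p : Rpos × Rpos => defect r p.1 p.2 := by
  have h1 : Continuous fun p : Rpos × Rpos => r p.1 :=
    h.continuousOn.comp_continuous (by fun_prop) fun p => p.1.pos.le
  have h2 : Continuous fun p : Rpos × Rpos => r p.2 :=
    h.continuousOn.comp_continuous (by fun_prop) fun p => p.2.pos.le
  have h3 : Continuous fun p : Rpos × Rpos => r (p.1 + p.2) :=
    h.continuousOn.comp_continuous (by fun_prop) fun p => (add_pos p.1.pos p.2.pos).le
  have h4 : Continuous fun p : Rpos × Rpos => (p.1 : ℝ) := by fun_prop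
  have h5 : Continuous fun p : Rpos × Rpos => (p.2 : ℝ) := by fun_prop
  exact ((((h4.add h5).mul h3).sub (h4.mul h1)).sub (h5.mul h2)).measurable

variable {μ : Measure Rpos}

lemma integrable_mul (h : DecayBound C r r') (hμ : HasMoment μ) :
    Integrable (fun x : Rpos => (x : ℝ) * r x) μ := by
  refine hμ.integrable_of_le (measurable_subtype_coe.mul h.measurable) (C := C) fun x => ?_
  have hx := x.pos.le
  rcases le_total 1 (x : ℝ) with h1 | h1
  · rw [min_eq_left h1, mul_one]
    exact h.abs_mul_le hx
  · rw [min_eq_right h1, abs_mul, abs_of_nonneg hx, mul_comm]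
    exact mul_le_mul_of_nonneg_right (h.abs_le hx) hx

lemma integrable_defect (h : DecayBound C r r') (hμ : HasMoment μ) :
    Integrable (fun p : Rpos × Rpos => defect r p.1 p.2) (μ.prod μ) := by
  have := hμ.sigmaFinite
  refine ((hμ.mul_prod hμ).const_mul (3 * C)).mono' h.measurable_defect.aestronglyMeasurable
    (Eventually.of_forall fun p => ?_)
  exact h.abs_defect_le p.1.pos.le p.2.pos.le

lemma abs_coagForm_le (h : DecayBound C r r') (hμ : HasMoment μ) :
    |coagForm constKernel r μ| ≤ 3 * C * (∫ x : Rpos, min 1 (x : ℝ) ∂μ) ^ 2 := by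
  have := hμ.sigmaFinite
  rw [coagForm_constKernel, pow_two, ← integral_prod_mul, ← integral_const_mul]
  exact norm_integral_le_of_norm_le (f := fun p : Rpos × Rpos => defect r p.1 p.2)
    ((hμ.mul_prod hμ).const_mul (3 * C))
    (Eventually.of_forall fun p => h.abs_defect_le p.1.pos.le p.2.pos.le)

lemma coagForm_sub (h : DecayBound C₁ r r') (k : DecayBound C₂ s s') (hμ : HasMoment μ) :
    coagForm constKernel (r - s) μ = coagForm constKernel r μ - coagForm constKernel s μ := by
  simp only [coagForm_constKernel]
  rw [← integral_sub (h.integrable_defect hμ) (k.integrable_defect hμ)]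
  refine integral_congr_ae (Eventually.of_forall fun p => ?_)
  simp only [defect, Pi.sub_apply]
  ring

end DecayBound

lemma decayBound_exp {l : ℝ} (hl : 0 < l) :
    DecayBound ((1 + 1 / l) * (1 + l)) (fun x => Real.exp (-l * x))
      (fun x => -l * Real.exp (-l * x)) := fun x hx => by
  have h1 := mul_exp_neg_le hl x
  have h2 : Real.exp (-l * x) ≤ 1 := Real.exp_le_one_iff.2 (by nlinarith)
  have h4 := Real.exp_pos (-l * x)
  have h3 : 0 < 1 / l := by positivity
  refine ⟨?_, ?_, ?_⟩
  · have h : HasDerivAt (fun x : ℝ => -l * x) (-l * 1) x := (hasDerivAt_id x).const_mul _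
    refine h.exp.hasDerivWithinAt.congr_deriv ?_
    ring
  · rw [abs_of_pos h4]
    nlinarith
  · rw [abs_mul, abs_neg, abs_of_pos h4, abs_of_pos hl]
    have : (1 + x) * Real.exp (-l * x) ≤ 1 + 1 / l := by linarith
    nlinarith

/-- Multiplicativity of the exponential turns the defect into a sum of two products of a function of
x and a function of y, and Fubini separates them. -/
lemma coagForm_exp {μ : Measure Rpos} (hμ : HasMoment μ) {l : ℝ} (hl : 0 < l) :
    coagForm constKernel (fun x => Real.exp (-l * x)) μ =
      -(2 * bernstein μ l * massLaplace μ l) := by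
  have := hμ.sigmaFinite
  have h1 := hμ.integrable_one_sub_exp hl.le
  have h2 := hμ.integrable_mul_exp hl
  have h : ∀ p : Rpos × Rpos, defect (fun x => Real.exp (-l * x)) p.1 p.2 =
      -((p.1 : ℝ) * Real.exp (-l * p.1) * (1 - Real.exp (-l * p.2))
        + (1 - Real.exp (-l * p.1)) * (p.2 * Real.exp (-l * p.2))) := fun p => by
    simp only [defect]
    rw [mul_add (-l), Real.exp_add]
    ring
  rw [coagForm_constKernel]
  simp only [h]
  rw [integral_neg, integral_add (h2.mul_prod h1) (h1.mul_prod h2),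
    integral_prod_mul (fun x : Rpos => (x : ℝ) * Real.exp (-l * x))
      (fun x : Rpos => 1 - Real.exp (-l * x)),
    integral_prod_mul (fun x : Rpos => 1 - Real.exp (-l * x))
      (fun x : Rpos => (x : ℝ) * Real.exp (-l * x))]
  unfold bernstein massLaplace
  ring

/-! ### Cutoffs, and exponentials as limits of test functions -/

lemma hasDerivAt_max_zero_sq (u : ℝ) :
    HasDerivAt (fun u : ℝ => max 0 u ^ 2) (2 * max 0 u) u := by
  rcases lt_trichotomy u 0 with h | rfl | h
  · rw [max_eq_left h.le, mul_zero]
    refine (hasDerivAt_const u (0 : ℝ)).congr_of_eventuallyEq ?_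
    filter_upwards [Iio_mem_nhds h] with v hv
    rw [max_eq_left (le_of_lt hv)]
    simp
  · rw [max_self, mul_zero, hasDerivAt_iff_isLittleO]
    refine Asymptotics.IsBigO.trans_isLittleO (g := fun v : ℝ => v ^ 2) ?_ ?_
    · refine Asymptotics.isBigO_of_le _ fun v => ?_
      rcases le_total v 0 with hv | hv
      · simp [max_eq_left hv, sq_nonneg]
      · simp [max_eq_right hv]
    · simpa using Asymptotics.isLittleO_pow_id (𝕜 := ℝ) one_lt_two
  · rw [max_eq_right h.le]
    have : HasDerivAt (fun u : ℝ => u ^ 2) (2 * u) u := by simpa using hasDerivAt_pow 2 u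
    refine this.congr_of_eventuallyEq ?_
    filter_upwards [Ioi_mem_nhds h] with v hv
    rw [max_eq_right (le_of_lt hv)]

/-- The nonincreasing `C¹` cutoff `max(0, 1 - x / R)²`. -/
def cutoff (R x : ℝ) : ℝ := max 0 (1 - x / R) ^ 2

lemma hasDerivAt_cutoff (R x : ℝ) :
    HasDerivAt (cutoff R) (-(2 * max 0 (1 - x / R) / R)) x := by
  have h : HasDerivAt (fun x : ℝ => 1 - x / R) (-(1 / R)) x :=
    ((hasDerivAt_id x).div_const R).const_sub 1
  refine ((hasDerivAt_max_zero_sq (1 - x / R)).comp x h).congr_deriv ?_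
  ring

lemma contDiff_cutoff (R : ℝ) : ContDiff ℝ 1 (cutoff R) := by
  rw [contDiff_one_iff_deriv]
  refine ⟨fun x => (hasDerivAt_cutoff R x).differentiableAt, ?_⟩
  rw [show deriv (cutoff R) = _ from funext fun x => (hasDerivAt_cutoff R x).deriv]
  fun_prop

lemma cutoff_nonneg (R x : ℝ) : 0 ≤ cutoff R x := sq_nonneg _

lemma cutoff_antitone {R : ℝ} (hR : 0 < R) : Antitone (cutoff R) := fun x y hxy => by
  unfold cutoff
  gcongr

lemma cutoff_zero (R : ℝ) : cutoff R 0 = 1 := by simp [cutoff]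

lemma cutoff_eq_zero {R x : ℝ} (hR : 0 < R) (hx : R ≤ x) : cutoff R x = 0 := by
  have : 1 - x / R ≤ 0 := by
    rw [sub_nonpos, le_div_iff₀ hR]
    linarith
  simp [cutoff, max_eq_left this]

lemma cutoff_le_one {R x : ℝ} (hR : 0 < R) (hx : 0 ≤ x) : cutoff R x ≤ 1 :=
  (cutoff_antitone hR hx).trans_eq (cutoff_zero R)

lemma one_sub_cutoff_le {R x : ℝ} (hR : 0 < R) (hx : 0 ≤ x) : 1 - cutoff R x ≤ 2 * (x / R) := by
  have hu : 0 ≤ x / R := by positivity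
  unfold cutoff
  rcases le_total (x / R) 1 with h | h
  · rw [max_eq_right (by linarith)]
    nlinarith
  · rw [max_eq_left (by linarith)]
    norm_num
    linarith

lemma isTest_mul_cutoff {g : ℝ → ℝ} (hg : ContDiff ℝ 1 g) {R : ℝ} (hR : 0 < R) :
    IsTest fun x => g x * cutoff R x :=
  ⟨(hg.mul (contDiff_cutoff R)).contDiffOn, R, fun x hx => by simp [cutoff_eq_zero hR hx]⟩

lemma isTest_cutoff {R : ℝ} (hR : 0 < R) : IsTest (cutoff R) := by
  simpa using isTest_mul_cutoff (contDiff_const (c := (1 : ℝ))) hR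

lemma sq_mul_exp_neg_le {l : ℝ} (hl : 0 < l) {x : ℝ} (hx : 0 ≤ x) :
    x ^ 2 * Real.exp (-l * x) ≤ 4 / l ^ 2 := by
  have h := mul_exp_neg_le (half_pos hl) x
  have h0 : 0 ≤ x * Real.exp (-(l / 2) * x) := by positivity
  have h2 := pow_le_pow_left₀ h0 h 2
  rw [mul_pow, ← Real.exp_nat_mul] at h2
  have e1 : ((2 : ℕ) : ℝ) * (-(l / 2) * x) = -l * x := by
    push_cast
    ring
  have e2 : (1 / (l / 2)) ^ 2 = 4 / l ^ 2 := by
    rw [div_pow, div_pow]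
    field_simp
    norm_num
  rwa [e1, e2] at h2

/-- Decaying exponentials are limits of test functions. -/
lemma exists_test_near_exp {l : ℝ} (hl : 0 < l) {ε : ℝ} (hε : 0 < ε) :
    ∃ χ, IsTest χ ∧ χ 0 = 1 ∧
      ∃ d, DecayBound ε ((fun x => Real.exp (-l * x)) - χ) d := by
  -- Cutting at R costs at most K/R in the weighted norm: the first summand pays for the function,
  -- the second for its derivative. Hence R = K/ε.
  set K : ℝ := 2 * (1 / l + 4 / l ^ 2) + 2 * (4 / l + (1 + l) / l + 1) with hK
  have hK0 : 0 < K := by positivity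
  have hR : 0 < K / ε := by positivity
  have hKR : K / (K / ε) = ε := by field_simp
  refine ⟨fun x => Real.exp (-l * x) * cutoff (K / ε) x,
    isTest_mul_cutoff (by fun_prop) hR, by simp [cutoff_zero],
    fun x => -l * Real.exp (-l * x) - (-l * Real.exp (-l * x) * cutoff (K / ε) x
      + Real.exp (-l * x) * -(2 * max 0 (1 - x / (K / ε)) / (K / ε))), fun x hx => ?_⟩
  set R := K / ε
  have e0 : Real.exp (-l * x) ≤ 1 := Real.exp_le_one_iff.2 (by nlinarith)
  have e1 := mul_exp_neg_le hl x
  have e2 := sq_mul_exp_neg_le hl hx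
  have ep := Real.exp_pos (-l * x)
  have c1 := cutoff_le_one hR hx
  have c2 := one_sub_cutoff_le hR hx
  have c3 : 0 ≤ max 0 (1 - x / R) := le_max_left _ _
  have c4 : max 0 (1 - x / R) ≤ 1 := max_le zero_le_one (by
    have : 0 ≤ x / R := by positivity
    linarith)
  have hexp : HasDerivAt (fun x : ℝ => Real.exp (-l * x)) (-l * Real.exp (-l * x)) x := by
    have h : HasDerivAt (fun x : ℝ => -l * x) (-l * 1) x := (hasDerivAt_id x).const_mul _
    refine h.exp.congr_deriv ?_
    ring
  have key : ∀ y, 0 ≤ y → y * R ≤ K → y ≤ ε := fun y _ h => by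
    rw [← hKR, le_div_iff₀ hR]
    exact h
  refine ⟨(hexp.sub (hexp.mul (hasDerivAt_cutoff R x))).hasDerivWithinAt, ?_, ?_⟩
  · have h1 : |((fun x => Real.exp (-l * x)) - fun x => Real.exp (-l * x) * cutoff R x) x|
        ≤ Real.exp (-l * x) * (2 * (x / R)) := by
      rw [Pi.sub_apply, show Real.exp (-l * x) - Real.exp (-l * x) * cutoff R x =
        Real.exp (-l * x) * (1 - cutoff R x) by ring, abs_of_nonneg (mul_nonneg ep.le (by linarith))]
      gcongr
    refine (mul_le_mul_of_nonneg_left h1 (by linarith)).trans (key _ (by positivity) ?_)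
    have : (1 + x) * (Real.exp (-l * x) * (2 * (x / R))) * R =
        2 * (x * Real.exp (-l * x) + x ^ 2 * Real.exp (-l * x)) := by
      field_simp
    rw [this, hK]
    have : 0 < 2 * (4 / l + (1 + l) / l + 1) := by positivity
    linarith
  · have h1 : |-l * Real.exp (-l * x) - (-l * Real.exp (-l * x) * cutoff R x
      + Real.exp (-l * x) * -(2 * max 0 (1 - x / R) / R))| ≤
        Real.exp (-l * x) * (l * (2 * (x / R)) + 2 / R) := by
      rw [show -l * Real.exp (-l * x) - (-l * Real.exp (-l * x) * cutoff R x
        + Real.exp (-l * x) * -(2 * max 0 (1 - x / R) / R)) = Real.exp (-l * x) *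
        (-(l * (1 - cutoff R x)) + 2 * max 0 (1 - x / R) / R) by ring, abs_mul, abs_of_pos ep]
      refine mul_le_mul_of_nonneg_left ((abs_add_le _ _).trans (add_le_add ?_ ?_)) ep.le
      · rw [abs_neg, abs_of_nonneg (mul_nonneg hl.le (by linarith))]
        gcongr
      · rw [abs_of_nonneg (by positivity)]
        gcongr
        linarith
    refine (mul_le_mul_of_nonneg_left h1 (by linarith)).trans (key _ (by positivity) ?_)
    have : (1 + x) * (Real.exp (-l * x) * (l * (2 * (x / R)) + 2 / R)) * R =
        2 * (l * (x ^ 2 * Real.exp (-l * x)) + (1 + l) * (x * Real.exp (-l * x))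
          + Real.exp (-l * x)) := by
      field_simp
      ring
    rw [this, hK]
    have a0 : 0 < 2 * (1 / l + 4 / l ^ 2) := by positivity
    have a1 := mul_le_mul_of_nonneg_left e1 (by linarith : 0 ≤ 1 + l)
    have a2 := mul_le_mul_of_nonneg_left e2 hl.le
    have a3 : l * (4 / l ^ 2) = 4 / l := by field_simp
    have a4 : (1 + l) * (1 / l) = (1 + l) / l := by ring
    linarith

/-! ### Test functions as limits of exponential sums -/

lemma le_exp_of_abs_deriv_le {r r' : ℝ → ℝ} {δ : ℝ}
    (hr : ∀ x, 0 ≤ x → HasDerivWithinAt r (r' x) (Set.Ici 0) x)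
    (hb : ∀ x, 0 ≤ x → |r' x| ≤ δ * Real.exp (-x)) (h0 : Tendsto r atTop (𝓝 0))
    {x : ℝ} (hx : 0 ≤ x) : r x ≤ δ * Real.exp (-x) := by
  have hm : MonotoneOn (fun x => r x - δ * Real.exp (-x)) (Set.Ici 0) := by
    refine monotoneOn_of_hasDerivWithinAt_nonneg (convex_Ici 0)
      (f' := fun x => r' x - δ * (Real.exp (-x) * (-1))) (fun x hx => ?_) (fun x hx => ?_)
      (fun x hx => ?_)
    · exact (hr x hx).continuousWithinAt.sub (by fun_prop)
    · have hx : 0 ≤ x := (interior_subset hx : x ∈ Set.Ici (0 : ℝ))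
      have he : HasDerivAt (fun x : ℝ => δ * Real.exp (-x)) (δ * (Real.exp (-x) * (-1))) x :=
        (hasDerivAt_neg x).exp.const_mul δ
      exact ((hr x hx).mono interior_subset).sub he.hasDerivWithinAt
    · have := abs_le.1 (hb x (interior_subset hx : x ∈ Set.Ici (0 : ℝ)))
      linarith
  have hl : Tendsto (fun x => r x - δ * Real.exp (-x)) atTop (𝓝 (0 - δ * 0)) :=
    h0.sub ((Real.tendsto_exp_atBot.comp tendsto_neg_atTop_atBot).const_mul δ)
  have : r x - δ * Real.exp (-x) ≤ 0 - δ * 0 := by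
    refine ge_of_tendsto hl ?_
    filter_upwards [eventually_ge_atTop x] with y hy
    exact hm hx (hx.trans hy : (0 : ℝ) ≤ y) hy
  linarith

lemma IsTest.exists_deriv {φ : ℝ → ℝ} (hφ : IsTest φ) :
    ∃ φ' : ℝ → ℝ, ∃ R : ℝ, 0 ≤ R ∧ ContinuousOn φ' (Set.Ici 0) ∧
      (∀ x, 0 ≤ x → HasDerivWithinAt φ (φ' x) (Set.Ici 0) x) ∧
      (∀ x, R ≤ x → φ x = 0) ∧ ∀ x, R ≤ x → φ' x = 0 := by
  obtain ⟨hd, R, hR⟩ := hφ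
  -- Adding 1 puts every point beyond the new radius in the interior of both [0, ∞) and the zero
  -- set, so the derivative vanishes there too.
  refine ⟨derivWithin φ (Set.Ici 0), max R 0 + 1, by positivity,
    hd.continuousOn_derivWithin (uniqueDiffOn_Ici 0) le_rfl,
    fun x hx => ((hd.differentiableOn one_ne_zero) x hx).hasDerivWithinAt,
    fun x hx => hR x (by linarith [le_max_left R 0]), fun x hx => ?_⟩
  have hx0 : 0 < x := by linarith [le_max_right R 0]
  rw [derivWithin_of_mem_nhds (Ici_mem_nhds hx0)]
  have : φ =ᶠ[𝓝 x] fun _ => 0 := by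
    filter_upwards [Ioi_mem_nhds (by linarith [le_max_left R 0] : R < x)] with y hy
    exact hR y (le_of_lt hy)
  rw [this.deriv_eq]
  simp

lemma IsTest.decayBound {φ : ℝ → ℝ} (hφ : IsTest φ) : ∃ C φ', DecayBound C φ φ' := by
  obtain ⟨φ', R, hR, hc, hd, h0, h0'⟩ := hφ.exists_deriv
  have hφc : ContinuousOn φ (Set.Ici 0) := fun x hx => (hd x hx).continuousWithinAt
  have hg : ContinuousOn (fun x => (1 + x) * |φ x| + (1 + x) * |φ' x|) (Set.Icc 0 R) :=
    ContinuousOn.mono (by fun_prop) Set.Icc_subset_Ici_self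
  obtain ⟨C, hC⟩ := isCompact_Icc.exists_bound_of_continuousOn hg
  have hC0 : 0 ≤ C := (norm_nonneg _).trans (hC 0 ⟨le_rfl, hR⟩)
  refine ⟨C, φ', fun x hx => ⟨hd x hx, ?_⟩⟩
  rcases le_total x R with h | h
  · have := (le_abs_self _).trans (hC x ⟨hx, h⟩)
    have a1 : 0 ≤ (1 + x) * |φ x| := by positivity
    have a2 : 0 ≤ (1 + x) * |φ' x| := by positivity
    constructor <;> linarith
  · simp [h0 x h, h0' x h, hC0]

/-- Finite linear combinations of the functions `x ↦ e^{-(i+1)x}`. -/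
def expSum (N : ℕ) (c : ℕ → ℝ) (x : ℝ) : ℝ :=
  ∑ i ∈ Finset.range N, c i * Real.exp (-((i : ℝ) + 1) * x)

lemma hasDerivAt_expSum (N : ℕ) (c : ℕ → ℝ) (x : ℝ) :
    HasDerivAt (expSum N c)
      (∑ i ∈ Finset.range N, c i * (-((i : ℝ) + 1) * Real.exp (-((i : ℝ) + 1) * x))) x := by
  unfold expSum
  refine HasDerivAt.fun_sum fun i _ => HasDerivAt.const_mul _ ?_
  have h : HasDerivAt (fun x : ℝ => -((i : ℝ) + 1) * x) (-((i : ℝ) + 1) * 1) x :=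
    (hasDerivAt_id x).const_mul _
  refine h.exp.congr_deriv ?_
  ring

lemma tendsto_expSum (N : ℕ) (c : ℕ → ℝ) : Tendsto (expSum N c) atTop (𝓝 0) := by
  have : Tendsto (expSum N c) atTop (𝓝 (∑ i ∈ Finset.range N, c i * 0)) := by
    refine tendsto_finsetSum _ fun i _ => Tendsto.const_mul _ ?_
    refine Real.tendsto_exp_atBot.comp ?_
    exact tendsto_id.const_mul_atTop_of_neg (by linarith [(Nat.cast_nonneg i : (0 : ℝ) ≤ i)])
  simpa using this

/-- Test functions are limits of linear combinations of decaying exponentials. -/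
lemma IsTest.exists_expSum_near {φ : ℝ → ℝ} (hφ : IsTest φ) {ε : ℝ} (hε : 0 < ε) :
    ∃ N c d, DecayBound ε (φ - expSum N c) d := by
  obtain ⟨φ', R, hR, hc, hd, h0, h0'⟩ := hφ.exists_deriv
  -- This inverts s = e^{-x}, clamped at x = R to stay continuous at s = 0; the clamp is harmless
  -- because φ' vanishes from R on.
  set y : ℝ → ℝ := fun s => -Real.log (max s (Real.exp (-R))) with hy
  have hypos : ∀ s, 0 < max s (Real.exp (-R)) := fun s => lt_max_of_lt_right (Real.exp_pos _)
  have hyc : Continuous y :=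
    (Continuous.log (by fun_prop) fun s => (hypos s).ne').neg
  have hy0 : ∀ s ∈ Set.Icc (0 : ℝ) 1, y s ∈ Set.Ici (0 : ℝ) := fun s hs => by
    have : max s (Real.exp (-R)) ≤ 1 := max_le hs.2 (Real.exp_le_one_iff.2 (by linarith))
    have := Real.log_nonpos (hypos s).le this
    simp only [hy, Set.mem_Ici]
    linarith
  -- Approximating e^x φ'(x) rather than φ(x) leaves an error ε e^{-x} in the derivative, which
  -- integrates from infinity to the same bound for the function.
  have hk : ContinuousOn (fun s => Real.exp (y s) * φ' (y s)) (Set.Icc 0 1) :=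
    (Real.continuous_exp.comp hyc).continuousOn.mul (hc.comp hyc.continuousOn hy0)
  obtain ⟨P, hP⟩ := exists_polynomial_near_of_continuousOn 0 1 _ hk ε hε
  have hkey : ∀ x, 0 ≤ x → |φ' x - Real.exp (-x) * P.eval (Real.exp (-x))| ≤
      ε * Real.exp (-x) := fun x hx => by
    have h1 := hP (Real.exp (-x)) ⟨(Real.exp_pos _).le, Real.exp_le_one_iff.2 (by linarith)⟩
    have h2 : Real.exp (-x) * (Real.exp (y (Real.exp (-x))) * φ' (y (Real.exp (-x)))) = φ' x := by
      rcases le_total x R with h | h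
      · have : y (Real.exp (-x)) = x := by
          simp only [hy]
          rw [max_eq_left (Real.exp_le_exp.2 (by linarith)), Real.log_exp, neg_neg]
        rw [this, ← mul_assoc, ← Real.exp_add]
        simp
      · have : y (Real.exp (-x)) = R := by
          simp only [hy]
          rw [max_eq_right (Real.exp_le_exp.2 (by linarith)), Real.log_exp, neg_neg]
        rw [this, h0' R le_rfl, h0' x h]
        simp
    rw [← h2, ← mul_sub, abs_mul, abs_of_pos (Real.exp_pos _), mul_comm, abs_sub_comm]
    exact mul_le_mul_of_nonneg_right h1.le (Real.exp_pos _).le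
  have hφ0 : Tendsto φ atTop (𝓝 0) := by
    refine tendsto_const_nhds.congr' ?_
    filter_upwards [eventually_ge_atTop R] with x hx using (h0 x hx).symm
  set N := P.natDegree + 1
  -- Coefficients of the antiderivative of e^{-x} P(e^{-x}) that vanishes at infinity.
  set c : ℕ → ℝ := fun i => -(P.coeff i / ((i : ℝ) + 1)) with hcdef
  set d : ℝ → ℝ := fun x => φ' x - Real.exp (-x) * P.eval (Real.exp (-x)) with hddef
  have hd' : ∀ x, 0 ≤ x → HasDerivWithinAt (φ - expSum N c) (d x) (Set.Ici 0) x := fun x hx => by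
    refine ((hd x hx).sub (hasDerivAt_expSum N c x).hasDerivWithinAt).congr_deriv ?_
    simp only [hddef]
    congr 1
    rw [Polynomial.eval_eq_sum_range, Finset.mul_sum]
    refine Finset.sum_congr rfl fun i _ => ?_
    have hi : ((i : ℝ) + 1) ≠ 0 := by positivity
    rw [← Real.exp_nat_mul, show -((i : ℝ) + 1) * x = -x + i * -x by ring, Real.exp_add]
    simp only [hcdef]
    field_simp
  have ht : Tendsto (φ - expSum N c) atTop (𝓝 0) := by
    have := hφ0.sub (tendsto_expSum N c)
    rwa [sub_zero] at this
  refine ⟨N, c, d, fun x hx => ⟨hd' x hx, ?_⟩⟩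
  have hle : |(φ - expSum N c) x| ≤ ε * Real.exp (-x) := by
    refine abs_le'.2 ⟨le_exp_of_abs_deriv_le hd' hkey ht hx, ?_⟩
    refine le_exp_of_abs_deriv_le (r := -(φ - expSum N c)) (r' := fun x => -d x)
      (fun x hx => (hd' x hx).neg) (fun x hx => ?_) (neg_zero (G := ℝ) ▸ ht.neg) hx
    rw [abs_neg]
    exact hkey x hx
  have h1 : (1 + x) * Real.exp (-x) ≤ 1 := by
    have a1 := Real.add_one_le_exp x
    have a2 : Real.exp x * Real.exp (-x) = 1 := by rw [← Real.exp_add]; simp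
    nlinarith [Real.exp_pos (-x)]
  have h2 := hkey x hx
  have h3 : 0 < 1 + x := by linarith
  constructor
  · have := mul_le_mul_of_nonneg_left hle h3.le
    nlinarith
  · have := mul_le_mul_of_nonneg_left h2 h3.le
    nlinarith

/-! ### Continuity theorems for Laplace and Bernstein transforms -/

/-- Used with e(x) = e^{-x} to view a C₀ function as a continuous function of s ∈ [0, 1]. Outside
the range, the complement of the image of a compact set is a neighbourhood on which the extension is
small. -/
lemma continuous_extend_zero {X Y : Type*} [TopologicalSpace X] [TopologicalSpace Y] [T2Space Y]
    {e : X → Y} (he : IsOpenEmbedding e) {h : X → ℝ} (hc : Continuous h)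
    (h0 : Tendsto h (cocompact X) (𝓝 0)) : Continuous (Function.extend e h 0) := by
  rw [continuous_iff_continuousAt]
  intro s
  by_cases hs : s ∈ Set.range e
  · obtain ⟨x, rfl⟩ := hs
    rw [← he.continuousAt_iff, Function.extend_comp he.injective]
    exact hc.continuousAt
  · have hs' : ¬∃ a, e a = s := hs
    rw [ContinuousAt, Function.extend_apply' _ _ _ hs', Pi.zero_apply, Metric.tendsto_nhds]
    intro ε hε
    have := Metric.tendsto_nhds.1 h0 ε hε
    obtain ⟨K, hK, hKs⟩ := mem_cocompact.1 this
    have hsK : s ∈ (e '' K)ᶜ := fun ⟨x, _, hx⟩ => hs ⟨x, hx⟩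
    filter_upwards [(hK.image he.continuous).isClosed.isOpen_compl.mem_nhds hsK] with y hy
    by_cases hy' : ∃ a, e a = y
    · obtain ⟨x, rfl⟩ := hy'
      rw [he.injective.extend_apply]
      exact hKs fun hx => hy ⟨x, hx, rfl⟩
    · rw [Function.extend_apply' _ _ _ hy']
      simpa using hε

lemma isOpenEmbedding_exp_neg : IsOpenEmbedding fun x : Rpos => Real.exp (-x) :=
  Real.isOpenEmbedding_exp.comp
    ((Homeomorph.neg ℝ).isOpenEmbedding.comp isOpen_Ioi.isOpenEmbedding_subtypeVal)

/-- Linear combinations of decaying exponentials are dense in `C₀(0, ∞)`. -/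
lemma exists_expSum_near (h : C₀(Rpos, ℝ)) {ε : ℝ} (hε : 0 < ε) :
    ∃ N c, ∀ x : Rpos, |h x - expSum N c x| ≤ ε := by
  set e : Rpos → ℝ := fun x => Real.exp (-x) with he
  set H : ℝ → ℝ := Function.extend e h 0
  have hH : Continuous H :=
    continuous_extend_zero isOpenEmbedding_exp_neg h.continuous h.zero_at_infty'
  have hHe : ∀ x, H (e x) = h x := fun x =>
    isOpenEmbedding_exp_neg.injective.extend_apply _ _ _
  have hH0 : H 0 = 0 :=
    Function.extend_apply' _ _ _ fun ⟨x, hx⟩ => (Real.exp_pos _).ne' hx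
  obtain ⟨P, hP⟩ := exists_polynomial_near_of_continuousOn 0 1 H hH.continuousOn _ (half_pos hε)
  -- The constant coefficient is dropped, since constants are not in C₀. It is within ε/2 of H(0) =
  -- 0, so the total error is still at most ε.
  refine ⟨P.natDegree, fun i => P.coeff (i + 1), fun x => ?_⟩
  have h0 := hP 0 ⟨le_rfl, zero_le_one⟩
  have h1 := hP (e x) ⟨(Real.exp_pos _).le, Real.exp_le_one_iff.2 (by linarith [x.pos])⟩
  have h2 : expSum P.natDegree (fun i => P.coeff (i + 1)) x = P.eval (e x) - P.eval 0 := by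
    rw [Polynomial.eval_eq_sum_range, Finset.sum_range_succ', ← Polynomial.coeff_zero_eq_eval_zero]
    simp only [expSum, pow_zero, mul_one, add_sub_cancel_right]
    refine Finset.sum_congr rfl fun i _ => ?_
    rw [he, ← Real.exp_nat_mul]
    congr 2
    push_cast
    ring
  rw [h2, ← hHe]
  rw [hH0, sub_zero] at h0
  rw [abs_lt] at h0 h1
  rw [abs_le]
  constructor <;> linarith

lemma integrable_exp_mul {ν : Measure Rpos} [IsFiniteMeasure ν] (n : ℕ) :
    Integrable (fun x : Rpos => Real.exp (-((n : ℝ) + 1) * x)) ν := by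
  refine Integrable.of_bound (by fun_prop) 1 (Eventually.of_forall fun x => ?_)
  rw [Real.norm_of_nonneg (Real.exp_pos _).le]
  have := x.pos
  exact Real.exp_le_one_iff.2 (by rw [neg_mul, neg_nonpos]; positivity)

lemma integrable_expSum {ν : Measure Rpos} [IsFiniteMeasure ν] (N : ℕ) (c : ℕ → ℝ) :
    Integrable (fun x : Rpos => expSum N c x) ν :=
  integrable_finsetSum _ fun i _ => (integrable_exp_mul i).const_mul (c i)

lemma integral_expSum {ν : Measure Rpos} [IsFiniteMeasure ν] (N : ℕ) (c : ℕ → ℝ) :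
    ∫ x : Rpos, expSum N c x ∂ν =
      ∑ i ∈ Finset.range N, c i * ∫ x : Rpos, Real.exp (-((i : ℝ) + 1) * x) ∂ν := by
  unfold expSum
  rw [integral_finsetSum _ fun i _ => (integrable_exp_mul i).const_mul (c i)]
  simp only [integral_const_mul]

lemma integrable_zeroAtInfty {ν : Measure Rpos} [IsFiniteMeasure ν] (h : C₀(Rpos, ℝ)) :
    Integrable h ν :=
  Integrable.of_bound h.continuous.measurable.aestronglyMeasurable ‖h.toBCF‖
    (Eventually.of_forall fun x => h.toBCF.norm_coe_le_norm x)

/-- Continuity theorem for Laplace transforms of finite measures, against `C₀(0, ∞)`. -/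
lemma tendsto_integral_of_tendsto_laplace {ι : Type*} {F : Filter ι} {ν : ι → Measure Rpos}
    {ν₀ : Measure Rpos} [∀ i, IsFiniteMeasure (ν i)] [IsFiniteMeasure ν₀] {B : ℝ}
    (hB : ∀ᶠ i in F, (ν i).real Set.univ ≤ B)
    (hν : ∀ n : ℕ, Tendsto (fun i => ∫ x : Rpos, Real.exp (-((n : ℝ) + 1) * x) ∂(ν i)) F
      (𝓝 (∫ x : Rpos, Real.exp (-((n : ℝ) + 1) * x) ∂ν₀)))
    (h : C₀(Rpos, ℝ)) :
    Tendsto (fun i => ∫ x, h x ∂(ν i)) F (𝓝 (∫ x, h x ∂ν₀)) := by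
  rw [Metric.tendsto_nhds]
  intro ε hε
  set M : ℝ := max (max B (ν₀.real Set.univ)) 1
  have hM : 0 < M := lt_max_of_lt_right one_pos
  have hδ : 0 < ε / (3 * M) := by positivity
  obtain ⟨N, c, hc⟩ := exists_expSum_near h hδ
  have key : ∀ (ρ : Measure Rpos) [IsFiniteMeasure ρ], ρ.real Set.univ ≤ M →
      |∫ x, h x ∂ρ - ∫ x : Rpos, expSum N c x ∂ρ| ≤ ε / 3 := fun ρ _ hρ => by
    rw [← integral_sub (integrable_zeroAtInfty h) (integrable_expSum N c)]
    refine (norm_integral_le_of_norm_le_const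
      (f := fun x : Rpos => h x - expSum N c x) (Eventually.of_forall hc)).trans ?_
    calc ε / (3 * M) * ρ.real Set.univ ≤ ε / (3 * M) * M := by gcongr
      _ = ε / 3 := by field_simp
  have hs : Tendsto (fun i => ∫ x : Rpos, expSum N c x ∂(ν i)) F
      (𝓝 (∫ x : Rpos, expSum N c x ∂ν₀)) := by
    simp only [integral_expSum]
    exact tendsto_finsetSum _ fun i _ => (hν i).const_mul (c i)
  filter_upwards [hB, Metric.tendsto_nhds.1 hs (ε / 3) (by positivity)] with i hi hi'
  have k1 := key (ν i) (hi.trans ((le_max_left _ _).trans (le_max_left _ _)))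
  have k2 := key ν₀ ((le_max_right _ _).trans (le_max_left _ _))
  rw [Real.dist_eq] at hi' ⊢
  rw [abs_lt] at hi' ⊢
  rw [abs_le] at k1 k2
  constructor <;> linarith

lemma integral_withDensity_ofReal {μ : Measure Rpos} {w : Rpos → ℝ} (hw : Measurable w)
    (hw0 : ∀ x, 0 ≤ w x) (g : Rpos → ℝ) :
    ∫ x, g x ∂(μ.withDensity fun x => ENNReal.ofReal (w x)) = ∫ x, w x * g x ∂μ := by
  rw [integral_withDensity_eq_integral_toReal_smul (by fun_prop)
    (Eventually.of_forall fun _ => ENNReal.ofReal_lt_top)]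
  simp only [ENNReal.toReal_ofReal (hw0 _), smul_eq_mul]

lemma integral_massMeasure (μ : Measure Rpos) (g : Rpos → ℝ) :
    ∫ x, g x ∂(massMeasure μ) = ∫ x : Rpos, (x : ℝ) * g x ∂μ :=
  integral_withDensity_ofReal measurable_subtype_coe (fun x => x.pos.le) g

lemma integral_exp_massMeasure (μ : Measure Rpos) (l : ℝ) :
    ∫ x : Rpos, Real.exp (-l * x) ∂(massMeasure μ) = massLaplace μ l :=
  integral_massMeasure μ _

/-- The measure `(1 - e^{-x}) μ(dx)`. -/
def bernsteinMeasure (μ : Measure Rpos) : Measure Rpos :=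
  μ.withDensity fun x => ENNReal.ofReal (1 - Real.exp (-1 * (x : ℝ)))

lemma integral_bernsteinMeasure (μ : Measure Rpos) (g : Rpos → ℝ) :
    ∫ x, g x ∂(bernsteinMeasure μ) = ∫ x : Rpos, (1 - Real.exp (-1 * (x : ℝ))) * g x ∂μ :=
  integral_withDensity_ofReal (by fun_prop) (fun x => one_sub_exp_nonneg zero_le_one x.pos.le) g

lemma HasMoment.isFiniteMeasure_bernsteinMeasure {μ : Measure Rpos} (hμ : HasMoment μ) :
    IsFiniteMeasure (bernsteinMeasure μ) :=
  isFiniteMeasure_withDensity_ofReal (hμ.integrable_one_sub_exp zero_le_one).2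

lemma bernsteinMeasure_real_univ (μ : Measure Rpos) :
    (bernsteinMeasure μ).real Set.univ = bernstein μ 1 := by
  have := integral_bernsteinMeasure μ fun _ => 1
  simpa [bernstein] using this

/-- The weight 1 - e^{-x} makes the measure finite and its Laplace transform an increment of the
Bernstein transform; this reduces Bernstein transforms to the finite-measure theorem. -/
lemma HasMoment.integral_exp_bernsteinMeasure {μ : Measure Rpos} (hμ : HasMoment μ) {l : ℝ}
    (hl : 0 ≤ l) :
    ∫ x : Rpos, Real.exp (-l * x) ∂(bernsteinMeasure μ) =
      bernstein μ (l + 1) - bernstein μ l := by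
  rw [integral_bernsteinMeasure]
  unfold bernstein
  rw [← integral_sub (hμ.integrable_one_sub_exp (by linarith)) (hμ.integrable_one_sub_exp hl)]
  refine integral_congr_ae (Eventually.of_forall fun x => ?_)
  simp only
  rw [show -(l + 1) * (x : ℝ) = -1 * x + -l * x by ring, Real.exp_add]
  ring

/-- Continuity theorem for Bernstein transforms, against `C_c(0, ∞)`. -/
lemma tendsto_integral_of_tendsto_bernstein {ι : Type*} {F : Filter ι} {μ : ι → Measure Rpos}
    {μ₀ : Measure Rpos} (hμ : ∀ i, HasMoment (μ i)) (hμ₀ : HasMoment μ₀)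
    (hconv : ∀ l, 0 < l → Tendsto (fun i => bernstein (μ i) l) F (𝓝 (bernstein μ₀ l)))
    (φ : C_c(Rpos, ℝ)) : Tendsto (fun i => ∫ x, φ x ∂(μ i)) F (𝓝 (∫ x, φ x ∂μ₀)) := by
  have hpos : ∀ x : Rpos, 0 < 1 - Real.exp (-1 * (x : ℝ)) := fun x => by
    have := x.pos
    have : Real.exp (-1 * (x : ℝ)) < 1 := Real.exp_lt_one_iff.2 (by linarith)
    linarith
  have hcont : Continuous fun x : Rpos => (1 - Real.exp (-1 * (x : ℝ)))⁻¹ * φ x :=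
    (Continuous.inv₀ (by fun_prop) fun x => (hpos x).ne').mul φ.continuous
  let h : C₀(Rpos, ℝ) :=
    ⟨⟨_, hcont⟩, HasCompactSupport.is_zero_at_infty φ.hasCompactSupport.mul_left⟩
  have hint : ∀ ρ : Measure Rpos, ∫ x, h x ∂(bernsteinMeasure ρ) = ∫ x, φ x ∂ρ := fun ρ => by
    rw [integral_bernsteinMeasure]
    refine integral_congr_ae (Eventually.of_forall fun x => ?_)
    exact mul_inv_cancel_left₀ (hpos x).ne' _
  have hfin := fun i => (hμ i).isFiniteMeasure_bernsteinMeasure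
  have hfin₀ := hμ₀.isFiniteMeasure_bernsteinMeasure
  simp only [← hint]
  refine tendsto_integral_of_tendsto_laplace (B := bernstein μ₀ 1 + 1) ?_ (fun n => ?_) h
  · simp only [bernsteinMeasure_real_univ]
    exact (hconv 1 one_pos).eventually_le_const (by linarith)
  · have hn : (0 : ℝ) < (n : ℝ) + 1 := by positivity
    simp only [(hμ _).integral_exp_bernsteinMeasure hn.le, hμ₀.integral_exp_bernsteinMeasure hn.le]
    exact (hconv _ (by linarith)).sub (hconv _ hn)

/-- The Bernstein transform determines the measure. -/
lemma HasMoment.ext_of_bernstein {μ₁ μ₂ : Measure Rpos} (h₁ : HasMoment μ₁) (h₂ : HasMoment μ₂)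
    (h : ∀ l, 0 < l → bernstein μ₁ l = bernstein μ₂ l) : μ₁ = μ₂ := by
  have := h₁.isFiniteMeasureOnCompacts
  have := h₂.isFiniteMeasureOnCompacts
  refine Measure.ext_of_integral_eq_on_compactlySupported fun φ => ?_
  -- Injectivity is the continuity theorem for a constant family.
  have := tendsto_integral_of_tendsto_bernstein (F := (⊤ : Filter Unit)) (μ := fun _ => μ₁)
    (fun _ => h₁) h₂ (fun l hl => by rw [h l hl]; exact tendsto_const_nhds) φ
  exact tendsto_nhds_unique tendsto_const_nhds this

/-! ### Passing between test functions and exponentials; the stationary equation -/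

section Linear

variable {μ : Measure Rpos} {C ε : ℝ} {φ φ' d ψ : ℝ → ℝ}

lemma DecayBound.abs_coagForm_sub_le (h : DecayBound C φ φ') (k : DecayBound ε (φ - ψ) d)
    (hμ : HasMoment μ) : |coagForm constKernel φ μ - coagForm constKernel ψ μ| ≤
      3 * ε * (∫ x : Rpos, min 1 (x : ℝ) ∂μ) ^ 2 := by
  -- A decay bound for ψ = φ - (φ - ψ) comes for free.
  have hψ := h.sub k
  rw [sub_sub_cancel] at hψ
  rw [← h.coagForm_sub hψ hμ]
  exact k.abs_coagForm_le hμ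

lemma DecayBound.abs_integral_massMeasure_sub_le (h : DecayBound C φ φ')
    (k : DecayBound ε (φ - ψ) d) [IsFiniteMeasure (massMeasure μ)] :
    |∫ x : Rpos, φ x ∂(massMeasure μ) - ∫ x : Rpos, ψ x ∂(massMeasure μ)| ≤
      ε * (massMeasure μ).real Set.univ := by
  have hψ := h.sub k
  rw [sub_sub_cancel] at hψ
  have hint {C : ℝ} {r r' : ℝ → ℝ} (h : DecayBound C r r') :
      Integrable (fun x : Rpos => r x) (massMeasure μ) :=
    Integrable.of_bound h.measurable.aestronglyMeasurable C
      (Eventually.of_forall fun x => h.abs_le x.pos.le)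
  rw [← integral_sub (hint h) (hint hψ)]
  exact norm_integral_le_of_norm_le_const (f := fun x : Rpos => φ x - ψ x)
    (Eventually.of_forall fun x => k.abs_le x.pos.le)

lemma coagForm_expSum (hμ : HasMoment μ) (N : ℕ) (c : ℕ → ℝ) :
    coagForm constKernel (expSum N c) μ =
      ∑ i ∈ Finset.range N, c i * -(2 * bernstein μ (i + 1) * massLaplace μ (i + 1)) := by
  have hpos : ∀ i : ℕ, (0 : ℝ) < (i : ℝ) + 1 := fun i => by positivity
  simp only [← coagForm_exp hμ (hpos _)]
  simp only [coagForm_constKernel, ← integral_const_mul]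
  rw [← integral_finsetSum _ fun i _ =>
    ((decayBound_exp (hpos i)).integrable_defect hμ).const_mul (c i)]
  refine integral_congr_ae (Eventually.of_forall fun p => ?_)
  simp only [defect, expSum, Finset.mul_sum, ← Finset.sum_sub_distrib]
  exact Finset.sum_congr rfl fun i _ => by ring

lemma expSum_zero (N : ℕ) (c : ℕ → ℝ) : expSum N c 0 = ∑ i ∈ Finset.range N, c i := by
  simp [expSum]

end Linear

lemma eq_of_forall_abs_sub_le {a b B : ℝ} (h : ∀ ε, 0 < ε → |a - b| ≤ ε * B) : a = b := by
  have h0 : Tendsto (fun ε : ℝ => ε * B) (𝓝[>] 0) (𝓝 (0 * B)) :=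
    ((continuous_id.mul continuous_const).tendsto 0).mono_left nhdsWithin_le_nhds
  have : |a - b| ≤ 0 * B := by
    refine ge_of_tendsto h0 ?_
    filter_upwards [self_mem_nhdsWithin] with ε hε using h ε hε
  rw [zero_mul] at this
  exact sub_eq_zero.1 (abs_eq_zero.1 (le_antisymm this (abs_nonneg _)))

/-- The stationary equation holds for all test functions as soon as it holds for exponentials. -/
lemma HasMoment.stationary_of_exp {μ : Measure Rpos} (hμ : HasMoment μ)
    (h : ∀ l, 0 < l → 2 * bernstein μ l * massLaplace μ l = 1) {φ : ℝ → ℝ} (hφ : IsTest φ) :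
    -coagForm constKernel φ μ = φ 0 := by
  refine eq_of_forall_abs_sub_le (B := 3 * (∫ x : Rpos, min 1 (x : ℝ) ∂μ) ^ 2 + 1) fun ε hε => ?_
  obtain ⟨C, φ', hC⟩ := hφ.decayBound
  obtain ⟨N, c, d, hd⟩ := hφ.exists_expSum_near hε
  have h1 := hC.abs_coagForm_sub_le hd hμ
  have h2 := hd.abs_le le_rfl
  rw [Pi.sub_apply, expSum_zero] at h2
  rw [coagForm_expSum hμ, Finset.sum_congr rfl fun i _ => by
    rw [h ((i : ℝ) + 1) (by positivity)]] at h1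
  simp only [mul_neg, mul_one, Finset.sum_neg_distrib] at h1
  rw [abs_le] at h1 h2 ⊢
  constructor <;> nlinarith

/-- If the stationary equation holds for test functions then it holds for exponentials. -/
lemma IsStationarySolution.exp_eq {μ : Measure Rpos} (hμ : IsStationarySolution μ) {l : ℝ}
    (hl : 0 < l) : 2 * bernstein μ l * massLaplace μ l = 1 := by
  refine eq_of_forall_abs_sub_le (B := 3 * (∫ x : Rpos, min 1 (x : ℝ) ∂μ) ^ 2) fun ε hε => ?_
  obtain ⟨χ, hχ, hχ0, d, hd⟩ := exists_test_near_exp hl hε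
  have h1 := (decayBound_exp hl).abs_coagForm_sub_le hd hμ.moment
  have h2 := hμ.equation χ hχ
  rw [coagForm_exp hμ.moment hl] at h1
  rw [hχ0] at h2
  rw [abs_le] at h1 ⊢
  constructor <;> linarith

/-- The equation for exponentials says that B² has derivative 1; it vanishes at 0+, and B ≥ 0
selects the root. -/
lemma IsStationarySolution.bernstein_eq {μ : Measure Rpos} (hμ : IsStationarySolution μ) {l : ℝ}
    (hl : 0 < l) : bernstein μ l = Real.sqrt l := by
  have hm : HasMoment μ := hμ.moment
  have h := eq_zero_of_deriv_eq_zero_of_tendsto (W := fun l => bernstein μ l ^ 2 - l)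
    (fun l hl => by
      refine (((hm.hasDerivAt_bernstein hl).pow 2).sub (hasDerivAt_id l)).congr_deriv ?_
      have := hμ.exp_eq hl
      simp
      linarith)
    (by
      have := (hm.tendsto_bernstein_zero.pow 2).sub
        (tendsto_id.mono_left (nhdsWithin_le_nhds (a := (0 : ℝ)) (s := Set.Ioi 0)))
      simpa using this) hl
  rw [eq_comm, Real.sqrt_eq_iff_mul_self_eq hl.le (bernstein_nonneg hl.le)]
  linarith

/-- Finiteness of mass from bounds on cut-off first moments. -/
lemma massMeasure_univ_le {μ : Measure Rpos} {w : ℕ → Rpos → ℝ} {B : ℝ}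
    (hw : ∀ n, Measurable (w n)) (hw0 : ∀ n x, 0 ≤ w n x)
    (hw1 : ∀ x, Tendsto (fun n => w n x) atTop (𝓝 1))
    (hi : ∀ n, Integrable (fun x : Rpos => (x : ℝ) * w n x) μ)
    (hB : ∀ n, ∫ x : Rpos, (x : ℝ) * w n x ∂μ ≤ B) :
    massMeasure μ Set.univ ≤ ENNReal.ofReal B := by
  rw [massMeasure, withDensity_apply _ MeasurableSet.univ, Measure.restrict_univ]
  have hlim : ∀ x : Rpos, liminf (fun n => ENNReal.ofReal ((x : ℝ) * w n x)) atTop =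
      ENNReal.ofReal x := fun x => by
    refine Tendsto.liminf_eq ((ENNReal.continuous_ofReal.tendsto _).comp ?_)
    simpa using (hw1 x).const_mul (x : ℝ)
  simp only [← hlim]
  refine (lintegral_liminf_le fun n => by fun_prop).trans ?_
  refine liminf_le_of_le (by isBoundedDefault) fun b hb => ?_
  obtain ⟨n, hn⟩ := hb.exists
  refine hn.trans ?_
  rw [← ofReal_integral_eq_lintegral_ofReal (hi n)
    (Eventually.of_forall fun x => mul_nonneg x.pos.le (hw0 n x))]
  exact ENNReal.ofReal_le_ofReal (hB n)

/-! ### Partial fractions of tanh and the explicit solution -/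

/-- The partial fraction expansion of the hyperbolic cotangent. -/
lemma hasSum_coth {w : ℝ} (hw : 0 < w) :
    HasSum (fun n : ℕ => 2 * w / (w ^ 2 + ((n : ℝ) + 1) ^ 2))
      (Real.pi * (Real.cosh (Real.pi * w) / Real.sinh (Real.pi * w)) - 1 / w) := by
  -- The expansion of π cot(πz) is evaluated on the imaginary axis, at z = iw.
  have hx : (w : ℂ) * Complex.I ∈ Complex.integerComplement := by
    rw [Complex.mem_integerComplement_iff]
    rintro ⟨n, hn⟩
    have := congrArg Complex.im hn
    simp at this
    exact hw.ne this
  have hs := (summable_cotTerm hx).hasSum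
  have hsum : ∑' n : ℕ, cotTerm ((w : ℂ) * Complex.I) n = _ := (cot_series_rep' hx).symm
  rw [hsum] at hs
  have hs := hs.mul_left Complex.I
  rw [← Complex.hasSum_ofReal]
  have hw' : (w : ℂ) ≠ 0 := by exact_mod_cast hw.ne'
  have hsinh : Complex.sinh (Real.pi * w) ≠ 0 := by
    have : Real.sinh (Real.pi * w) ≠ 0 := (Real.sinh_pos_iff.2 (by positivity)).ne'
    exact_mod_cast this
  have hterm : ∀ n : ℕ, ((2 * w / (w ^ 2 + ((n : ℝ) + 1) ^ 2) : ℝ) : ℂ) =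
      Complex.I * cotTerm ((w : ℂ) * Complex.I) n := fun n => by
    rw [cotTerm_identity hx]
    have h1 : ((w : ℂ) ^ 2 + ((n : ℂ) + 1) ^ 2) ≠ 0 := by
      have : (w ^ 2 + ((n : ℝ) + 1) ^ 2) ≠ 0 := by positivity
      exact_mod_cast this
    have h2 : ((w : ℂ) * Complex.I + (n + 1)) * (w * Complex.I - (n + 1)) =
        -((w : ℂ) ^ 2 + ((n : ℂ) + 1) ^ 2) := by
      ring_nf
      rw [Complex.I_sq]
      ring
    rw [h2]
    push_cast
    field_simp
    rw [Complex.I_sq]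
    ring
  have hval : ((Real.pi * (Real.cosh (Real.pi * w) / Real.sinh (Real.pi * w)) - 1 / w : ℝ) : ℂ) =
      Complex.I * (Real.pi * Complex.cot (Real.pi * ((w : ℂ) * Complex.I)) -
        1 / ((w : ℂ) * Complex.I)) := by
    rw [Complex.cot_eq_cos_div_sin, ← mul_assoc (Real.pi : ℂ) (w : ℂ), Complex.cos_mul_I,
      Complex.sin_mul_I]
    push_cast
    field_simp
  simp_rw [hterm, hval]
  exact hs

lemma two_mul_coth_sub_coth {z : ℝ} (hz : 0 < z) :
    2 * (Real.cosh (2 * z) / Real.sinh (2 * z)) - Real.cosh z / Real.sinh z = Real.tanh z := by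
  have h1 : Real.sinh z ≠ 0 := (Real.sinh_pos_iff.2 hz).ne'
  have h2 : Real.cosh z ≠ 0 := (Real.cosh_pos z).ne'
  rw [Real.cosh_two_mul, Real.sinh_two_mul, Real.tanh_eq_sinh_div_cosh]
  field_simp
  ring

/-- The partial fraction expansion of the hyperbolic tangent. -/
lemma hasSum_tanh {z : ℝ} (hz : 0 < z) :
    HasSum (fun k : ℕ => 2 * z / (z ^ 2 + (((k : ℝ) + 1 / 2) * Real.pi) ^ 2)) (Real.tanh z) := by
  have hpi := Real.pi_pos
  have hv : 0 < z / Real.pi := by positivity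
  -- With v = z/π, half the series at v is the odd-indexed part of the series at 2v. What remains
  -- has denominators (2v)² + (2k+1)², the half-integer poles of tanh.
  have hS := hasSum_coth (mul_pos two_pos hv)
  have hodd := (hasSum_coth hv).div_const 2
  set f : ℕ → ℝ := fun n =>
    2 * (2 * (z / Real.pi)) / ((2 * (z / Real.pi)) ^ 2 + ((n : ℝ) + 1) ^ 2) with hf
  have hfodd : ∀ k : ℕ, 2 * (z / Real.pi) / ((z / Real.pi) ^ 2 + ((k : ℝ) + 1) ^ 2) / 2 =
      f (2 * k + 1) := fun k => by
    simp only [hf]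
    push_cast
    field_simp
    ring
  simp_rw [hfodd] at hodd
  have he : Summable fun k : ℕ => f (2 * k) :=
    hS.summable.comp_injective (mul_right_injective₀ two_ne_zero)
  have htot := (he.hasSum.even_add_odd hodd).unique hS
  have h1 : Real.pi * (2 * (z / Real.pi)) = 2 * z := by field_simp
  have h2 : Real.pi * (z / Real.pi) = z := by field_simp
  rw [h1, h2] at htot
  have h3 : (∑' k : ℕ, f (2 * k)) * (2 / Real.pi) = Real.tanh z := by
    rw [← two_mul_coth_sub_coth hz, eq_sub_of_add_eq htot]
    field_simp
    ring
  rw [← h3]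
  have hfeven : ∀ k : ℕ, 2 * z / (z ^ 2 + (((k : ℝ) + 1 / 2) * Real.pi) ^ 2) =
      f (2 * k) * (2 / Real.pi) := fun k => by
    simp only [hf]
    push_cast
    field_simp
  simp_rw [hfeven]
  exact he.hasSum.mul_right (2 / Real.pi)

/-- The reference measure `dx` on `(0, ∞)`. -/
def lebesguePos : Measure Rpos := (volume : Measure ℝ).comap Subtype.val

lemma lintegral_lebesguePos (f : ℝ → ℝ≥0∞) :
    ∫⁻ x : Rpos, f x ∂lebesguePos = ∫⁻ x in Set.Ioi (0 : ℝ), f x :=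
  lintegral_subtype_comap measurableSet_Ioi f

/-- The exponential distribution with rate `a`, on `(0, ∞)`. -/
def expLaw (a : ℝ) : Measure Rpos :=
  lebesguePos.withDensity fun x => ENNReal.ofReal (a * Real.exp (-a * x))

lemma lintegral_one_sub_exp_expLaw {a l : ℝ} (ha : 0 < a) (hl : 0 < l) :
    ∫⁻ x : Rpos, ENNReal.ofReal (1 - Real.exp (-l * x)) ∂(expLaw a) =
      ENNReal.ofReal (l / (l + a)) := by
  have hm : Measurable fun x : Rpos => ENNReal.ofReal (a * Real.exp (-a * x)) := by fun_prop
  rw [expLaw, lintegral_withDensity_eq_lintegral_mul _ hm (by fun_prop)]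
  have h1 : ∀ x : Rpos, ((fun x : Rpos => ENNReal.ofReal (a * Real.exp (-a * x))) *
      fun x : Rpos => ENNReal.ofReal (1 - Real.exp (-l * x))) x =
      (fun x : ℝ => ENNReal.ofReal (a * Real.exp (-a * x) - a * Real.exp (-(l + a) * x))) x :=
    fun x => by
      simp only [Pi.mul_apply]
      rw [← ENNReal.ofReal_mul (by positivity), show -(l + a) * (x : ℝ) = -a * x + -l * x by ring,
        Real.exp_add]
      congr 1
      ring
  rw [lintegral_congr h1, lintegral_lebesguePos fun x =>
    ENNReal.ofReal (a * Real.exp (-a * x) - a * Real.exp (-(l + a) * x))]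
  have ha' : -a < 0 := by linarith
  have hla' : -(l + a) < 0 := by linarith
  have i1 := (integrableOn_exp_mul_Ioi ha' 0).const_mul a
  have i2 := (integrableOn_exp_mul_Ioi hla' 0).const_mul a
  rw [← ofReal_integral_eq_lintegral_ofReal
    (f := fun x : ℝ => a * Real.exp (-a * x) - a * Real.exp (-(l + a) * x)) (i1.sub i2)]
  · congr 1
    rw [integral_sub i1 i2, integral_const_mul, integral_const_mul, integral_exp_mul_Ioi ha',
      integral_exp_mul_Ioi hla']
    have : l + a ≠ 0 := by positivity
    simp only [mul_zero, Real.exp_zero]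
    field_simp
    ring
  · filter_upwards [self_mem_ae_restrict measurableSet_Ioi] with x hx
    have hx : 0 < x := hx
    have : Real.exp (-(l + a) * x) ≤ Real.exp (-a * x) := Real.exp_le_exp.2 (by nlinarith)
    have := mul_le_mul_of_nonneg_left this ha.le
    simpa using this

/-- The solution with zero initial data, as a superposition of exponential distributions. -/
def fluxSol (t : ℝ≥0) : Measure Rpos :=
  Measure.sum fun k : ℕ => ENNReal.ofReal (2 / t) •
    expLaw ((((k : ℝ) + 1 / 2) * Real.pi / t) ^ 2)

/-- At t = 0 the weight 2/t is 0 by the convention for division, so the formula already gives the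
zero measure. -/
lemma fluxSol_zero : fluxSol 0 = 0 := by
  simp [fluxSol]

/-- The tanh series at √l t, multiplied by √l, has terms (2/t) l/(l + a_k), where a_k is the rate of
the k-th exponential law. Stated for the extended integral, it also yields the moment condition. -/
lemma lintegral_one_sub_exp_fluxSol (t : ℝ≥0) {l : ℝ} (hl : 0 < l) :
    ∫⁻ x : Rpos, ENNReal.ofReal (1 - Real.exp (-l * x)) ∂(fluxSol t) =
      ENNReal.ofReal (Real.sqrt l * Real.tanh (Real.sqrt l * t)) := by
  rcases eq_or_ne t 0 with rfl | ht
  · simp [fluxSol_zero]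
  have ht : (0 : ℝ) < t := by positivity
  have hs : 0 < Real.sqrt l := Real.sqrt_pos.2 hl
  have hS := (hasSum_tanh (mul_pos hs ht)).mul_left (Real.sqrt l)
  have hterm : ∀ k : ℕ, 0 < ((((k : ℝ) + 1 / 2) * Real.pi / t) ^ 2) := fun k => by
    have := Real.pi_pos
    positivity
  rw [fluxSol, lintegral_sum_measure]
  simp only [lintegral_smul_measure, lintegral_one_sub_exp_expLaw (hterm _) hl, smul_eq_mul]
  rw [← hS.tsum_eq, ENNReal.ofReal_tsum_of_nonneg (fun k => by positivity) hS.summable]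
  refine tsum_congr fun k => ?_
  rw [← ENNReal.ofReal_mul (by positivity)]
  congr 1
  have hsq : l = Real.sqrt l ^ 2 := (Real.sq_sqrt hl.le).symm
  have hpi := Real.pi_pos
  have := hterm k
  set s := Real.sqrt l
  rw [hsq]
  field_simp

lemma min_one_le_two_mul {x : ℝ} (hx : 0 ≤ x) : min 1 x ≤ 2 * (1 - Real.exp (-1 * x)) := by
  have h1 := Real.add_one_le_exp x
  have h2 : Real.exp x * Real.exp (-1 * x) = 1 := by rw [← Real.exp_add]; simp
  have h3 := Real.exp_pos (-1 * x)
  have h4 : (1 + x) * Real.exp (-1 * x) ≤ 1 := by nlinarith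
  rcases le_total 1 x with h | h
  · rw [min_eq_left h]; nlinarith
  · rw [min_eq_right h]; nlinarith

lemma hasMoment_of_lintegral {μ : Measure Rpos}
    (h : ∫⁻ x : Rpos, ENNReal.ofReal (1 - Real.exp (-1 * (x : ℝ))) ∂μ ≠ ∞) : HasMoment μ := by
  have hi : Integrable (fun x : Rpos => 1 - Real.exp (-1 * (x : ℝ))) μ := by
    refine (lintegral_ofReal_ne_top_iff_integrable ?_ ?_).1 h
    · exact (by fun_prop : Measurable fun x : Rpos =>
        1 - Real.exp (-1 * (x : ℝ))).aestronglyMeasurable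
    · exact Eventually.of_forall fun x => one_sub_exp_nonneg zero_le_one x.pos.le
  refine (hi.const_mul 2).mono' (by fun_prop) (Eventually.of_forall fun x => ?_)
  rw [Real.norm_of_nonneg (min_one_pos x).le]
  exact min_one_le_two_mul x.pos.le

lemma hasMoment_fluxSol (t : ℝ≥0) : HasMoment (fluxSol t) :=
  hasMoment_of_lintegral ((lintegral_one_sub_exp_fluxSol t one_pos).trans_ne ENNReal.ofReal_ne_top)

lemma tanh_nonneg {z : ℝ} (hz : 0 ≤ z) : 0 ≤ Real.tanh z := by
  rw [Real.tanh_eq_sinh_div_cosh]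
  exact div_nonneg (Real.sinh_nonneg_iff.2 hz) (Real.cosh_pos z).le

lemma bernstein_fluxSol (t : ℝ≥0) {l : ℝ} (hl : 0 < l) :
    bernstein (fluxSol t) l = Real.sqrt l * Real.tanh (Real.sqrt l * t) := by
  rw [bernstein, integral_eq_lintegral_of_nonneg_ae
    (Eventually.of_forall fun x => one_sub_exp_nonneg hl.le x.pos.le)
    ((hasMoment_fluxSol t).integrable_one_sub_exp hl.le).aestronglyMeasurable,
    lintegral_one_sub_exp_fluxSol t hl, ENNReal.toReal_ofReal]
  exact mul_nonneg (Real.sqrt_nonneg l) (tanh_nonneg (by positivity))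

lemma hasDerivAt_tanh (z : ℝ) : HasDerivAt Real.tanh (1 - Real.tanh z ^ 2) z := by
  have hc := (Real.cosh_pos z).ne'
  have h := (Real.hasDerivAt_sinh z).div (Real.hasDerivAt_cosh z) hc
  have he : Real.tanh = Real.sinh / Real.cosh := funext fun x => Real.tanh_eq_sinh_div_cosh x
  rw [he]
  refine h.congr_deriv ?_
  simp only [Pi.div_apply]
  field_simp

lemma continuous_tanh : Continuous Real.tanh :=
  continuous_iff_continuousAt.2 fun z => (hasDerivAt_tanh z).continuousAt

lemma tendsto_tanh_atTop : Tendsto Real.tanh atTop (𝓝 1) := by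
  have h : Tendsto (fun z : ℝ => 1 - 2 / (Real.exp (2 * z) + 1)) atTop (𝓝 (1 - 0)) := by
    refine Tendsto.const_sub 1 (Tendsto.const_div_atTop ?_ 2)
    exact tendsto_atTop_add_const_right _ _
      (Real.tendsto_exp_atTop.comp (tendsto_id.const_mul_atTop two_pos))
  rw [sub_zero] at h
  refine h.congr fun z => ?_
  have h1 : Real.exp (2 * z) = Real.exp z * Real.exp z := by rw [← Real.exp_add]; ring_nf
  have h2 := Real.exp_pos z
  rw [Real.tanh_eq, h1, Real.exp_neg]
  field_simp
  ring

/-- The derivative in `λ` of `√λ tanh(√λ t)`, at `√λ = s`. -/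
def profile (s t : ℝ) : ℝ :=
  Real.tanh (s * t) / (2 * s) + t / 2 * (1 - Real.tanh (s * t) ^ 2)

lemma massLaplace_fluxSol (t : ℝ≥0) {l : ℝ} (hl : 0 < l) :
    massLaplace (fluxSol t) l = profile (Real.sqrt l) t := by
  have h1 := (hasMoment_fluxSol t).hasDerivAt_bernstein hl
  have hs := Real.hasDerivAt_sqrt hl.ne'
  have h2 := hs.mul ((hasDerivAt_tanh (Real.sqrt l * t)).comp l (hs.mul_const (t : ℝ)))
  refine h1.unique ((h2.congr_of_eventuallyEq ?_).congr_deriv ?_)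
  · filter_upwards [Ioi_mem_nhds hl] with k hk using bernstein_fluxSol t hk
  · have : 0 < Real.sqrt l := Real.sqrt_pos.2 hl
    simp only [profile, Function.comp]
    field_simp

/-- This is the flux equation tested against e^{-λx} with λ = s², in differential form: ∂_t B' = 1 -
2 B B'. -/
lemma hasDerivAt_profile {s : ℝ} (hs : s ≠ 0) (t : ℝ) :
    HasDerivAt (profile s) (1 - 2 * (s * Real.tanh (s * t)) * profile s t) t := by
  have hi : HasDerivAt (fun t : ℝ => s * t) (s * 1) t := (hasDerivAt_id t).const_mul s
  have hT := (hasDerivAt_tanh (s * t)).comp t hi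
  have h := (hT.div_const (2 * s)).add
    (((hasDerivAt_id t).div_const 2).mul ((hT.pow 2).const_sub 1))
  refine h.congr_deriv ?_
  simp only [profile, Function.comp, id, Pi.pow_apply]
  field_simp
  push_cast
  ring

lemma continuous_profile {s : ℝ} (hs : s ≠ 0) : Continuous (profile s) :=
  continuous_iff_continuousAt.2 fun t => (hasDerivAt_profile hs t).continuousAt

lemma massMeasure_real_univ (μ : Measure Rpos) :
    (massMeasure μ).real Set.univ = ∫ x : Rpos, (x : ℝ) ∂μ := by
  have := integral_massMeasure μ fun _ => 1
  simpa using this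

/-! ### Mass bounds, and the explicit measures form a flux solution -/

section FiniteMass

variable (μ : Measure Rpos) [IsFiniteMeasure (massMeasure μ)]

lemma integrable_size : Integrable (fun x : Rpos => (x : ℝ)) μ := by
  refine (lintegral_ofReal_ne_top_iff_integrable (f := fun x : Rpos => (x : ℝ))
    measurable_subtype_coe.aestronglyMeasurable
    (Eventually.of_forall fun x => x.pos.le)).1 ?_
  have := measure_ne_top (massMeasure μ) Set.univ
  rwa [massMeasure, withDensity_apply _ MeasurableSet.univ, Measure.restrict_univ] at this

lemma hasMoment_of_isFiniteMeasure_massMeasure : HasMoment μ := by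
  refine (integrable_size μ).mono' (by fun_prop) (Eventually.of_forall fun x => ?_)
  rw [Real.norm_of_nonneg (min_one_pos x).le]
  exact min_le_right _ _

lemma integral_min_one_le : ∫ x : Rpos, min 1 (x : ℝ) ∂μ ≤ (massMeasure μ).real Set.univ := by
  rw [massMeasure_real_univ]
  exact integral_mono (hasMoment_of_isFiniteMeasure_massMeasure μ) (integrable_size μ)
    fun x => min_le_right _ _

end FiniteMass

lemma massMeasure_real_univ_le {μ : Measure Rpos} {B : ℝ} (hB : 0 ≤ B)
    (h : massMeasure μ Set.univ ≤ ENNReal.ofReal B) : (massMeasure μ).real Set.univ ≤ B :=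
  ENNReal.toReal_le_of_le_ofReal hB h

lemma sq_integral_min_one_le {μ : Measure Rpos} {B : ℝ} (hB : 0 ≤ B)
    (h : massMeasure μ Set.univ ≤ ENNReal.ofReal B) :
    (∫ x : Rpos, min 1 (x : ℝ) ∂μ) ^ 2 ≤ B ^ 2 := by
  have : IsFiniteMeasure (massMeasure μ) := ⟨h.trans_lt ENNReal.ofReal_lt_top⟩
  refine pow_le_pow_left₀ (integral_nonneg fun x => (min_one_pos x).le) ?_ 2
  exact (integral_min_one_le μ).trans (massMeasure_real_univ_le hB h)

lemma tanh_le_self {z : ℝ} (hz : 0 ≤ z) : Real.tanh z ≤ z := by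
  have hm : Monotone fun z : ℝ => z - Real.tanh z :=
    monotone_of_hasDerivAt_nonneg (f' := fun z => 1 - (1 - Real.tanh z ^ 2))
      (fun z => (hasDerivAt_id z).sub (hasDerivAt_tanh z)) fun z => by
        simp only [Pi.zero_apply, sub_sub_cancel]
        positivity
  have := hm hz
  simp only [Real.tanh_zero, sub_zero] at this
  linarith

lemma profile_le {s t : ℝ} (hs : 0 < s) (ht : 0 ≤ t) : profile s t ≤ t := by
  have h1 : Real.tanh (s * t) / (2 * s) ≤ t / 2 := by
    rw [div_le_iff₀ (by positivity)]
    have := tanh_le_self (mul_nonneg hs.le ht)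
    linarith
  have h2 : t / 2 * (1 - Real.tanh (s * t) ^ 2) ≤ t / 2 * 1 := by
    gcongr
    linarith [sq_nonneg (Real.tanh (s * t))]
  unfold profile
  linarith

lemma profile_zero (s : ℝ) : profile s 0 = 0 := by simp [profile]

/-- The Laplace transform of the mass measure is at most t for every l > 0; let l = 1/(n+1) tend to
0. -/
lemma massMeasure_fluxSol_univ_le (t : ℝ≥0) :
    massMeasure (fluxSol t) Set.univ ≤ ENNReal.ofReal t := by
  have hn : ∀ n : ℕ, (0 : ℝ) < 1 / ((n : ℝ) + 1) := fun n => by positivity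
  refine massMeasure_univ_le (w := fun n x => Real.exp (-(1 / ((n : ℝ) + 1)) * x))
    (fun n => by fun_prop) (fun n x => (Real.exp_pos _).le) (fun x => ?_)
    (fun n => (hasMoment_fluxSol t).integrable_mul_exp (hn n)) (fun n => ?_)
  · have h : Continuous fun r : ℝ => Real.exp (-r * x) := by fun_prop
    have := (h.tendsto 0).comp (tendsto_one_div_add_atTop_nhds_zero_nat (𝕜 := ℝ))
    rwa [neg_zero, zero_mul, Real.exp_zero] at this
  · exact (massLaplace_fluxSol t (hn n)).trans_le
      (profile_le (Real.sqrt_pos.2 (hn n)) t.coe_nonneg)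

instance isFiniteMeasure_massMeasure_fluxSol (t : ℝ≥0) :
    IsFiniteMeasure (massMeasure (fluxSol t)) :=
  ⟨(massMeasure_fluxSol_univ_le t).trans_lt ENNReal.ofReal_lt_top⟩

lemma continuous_integral_fluxSol (φ : C_c(Rpos, ℝ)) :
    Continuous fun t => ∫ x, φ x ∂(fluxSol t) := by
  refine continuous_iff_continuousAt.2 fun t₀ =>
    tendsto_integral_of_tendsto_bernstein hasMoment_fluxSol (hasMoment_fluxSol t₀)
      (fun l hl => ?_) φ
  simp only [bernstein_fluxSol _ hl]
  have : Continuous fun t : ℝ≥0 => Real.sqrt l * Real.tanh (Real.sqrt l * t) :=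
    (continuous_tanh.comp (by fun_prop)).const_mul _
  exact this.tendsto t₀

lemma continuous_integral_massMeasure_fluxSol (φ : C₀(Rpos, ℝ)) :
    Continuous fun t => ∫ x, φ x ∂(massMeasure (fluxSol t)) := by
  refine continuous_iff_continuousAt.2 fun t₀ =>
    tendsto_integral_of_tendsto_laplace (B := t₀ + 1) ?_ (fun n => ?_) φ
  · have h1 : ∀ᶠ t : ℝ≥0 in 𝓝 t₀, (t : ℝ) < t₀ + 1 :=
      (NNReal.continuous_coe.tendsto t₀).eventually_lt_const (by simp)
    filter_upwards [h1] with t ht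
    exact (massMeasure_real_univ_le t.coe_nonneg (massMeasure_fluxSol_univ_le t)).trans ht.le
  · have hn : (0 : ℝ) < (n : ℝ) + 1 := by positivity
    simp only [integral_exp_massMeasure, massLaplace_fluxSol _ hn]
    exact ((continuous_profile (Real.sqrt_pos.2 hn).ne').comp NNReal.continuous_coe).tendsto t₀

/-- The value of `coagForm` at `expSum N c` along `fluxSol`. -/
def coagExpSum (N : ℕ) (c : ℕ → ℝ) (s : ℝ) : ℝ :=
  ∑ i ∈ Finset.range N, c i * -(2 * (Real.sqrt (i + 1) * Real.tanh (Real.sqrt (i + 1) * s)) *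
    profile (Real.sqrt (i + 1)) s)

lemma sqrt_nat_add_one_ne_zero (i : ℕ) : Real.sqrt ((i : ℝ) + 1) ≠ 0 :=
  (Real.sqrt_pos.2 (by positivity)).ne'

lemma coagForm_expSum_fluxSol (N : ℕ) (c : ℕ → ℝ) {s : ℝ} (hs : 0 ≤ s) :
    coagForm constKernel (expSum N c) (fluxSol s.toNNReal) = coagExpSum N c s := by
  rw [coagForm_expSum (hasMoment_fluxSol _)]
  refine Finset.sum_congr rfl fun i _ => ?_
  have hi : (0 : ℝ) < (i : ℝ) + 1 := by positivity
  rw [bernstein_fluxSol _ hi, massLaplace_fluxSol _ hi, Real.coe_toNNReal s hs]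

lemma continuous_coagExpSum (N : ℕ) (c : ℕ → ℝ) : Continuous (coagExpSum N c) := by
  refine continuous_finsetSum _ fun i _ => continuous_const.mul (Continuous.neg ?_)
  refine Continuous.mul (continuous_const.mul (continuous_const.mul ?_))
    (continuous_profile (sqrt_nat_add_one_ne_zero i))
  exact continuous_tanh.comp (by fun_prop)

/-- The flux equation holds exactly for exponential sums, by the fundamental theorem of calculus;
other test functions follow by approximation. -/
lemma integral_coagExpSum (N : ℕ) (c : ℕ → ℝ) (t : ℝ≥0) :
    ∫ s in (0 : ℝ)..t, coagExpSum N c s =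
      ∫ x : Rpos, expSum N c x ∂(massMeasure (fluxSol t)) - t * expSum N c 0 := by
  have hd : ∀ s ∈ Set.uIcc (0 : ℝ) t, HasDerivAt
      (fun s => ∑ i ∈ Finset.range N, c i * (profile (Real.sqrt (i + 1)) s - s))
      (coagExpSum N c s) s := fun s _ => by
    refine HasDerivAt.fun_sum fun i _ => HasDerivAt.const_mul _ ?_
    refine ((hasDerivAt_profile (sqrt_nat_add_one_ne_zero i) s).sub
      (hasDerivAt_id s)).congr_deriv ?_
    ring
  rw [intervalIntegral.integral_eq_sub_of_hasDerivAt hd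
    ((continuous_coagExpSum N c).intervalIntegrable _ _), integral_expSum, expSum_zero,
    Finset.mul_sum, ← Finset.sum_sub_distrib, ← Finset.sum_sub_distrib]
  refine Finset.sum_congr rfl fun i _ => ?_
  have hi : (0 : ℝ) < (i : ℝ) + 1 := by positivity
  rw [integral_exp_massMeasure, massLaplace_fluxSol _ hi, profile_zero]
  ring

/-- One exponential sum serves all times at once: the mass bound turns the errors into ε t and 3 ε
s². -/
lemma exists_coagForm_near {φ : ℝ → ℝ} (hφ : IsTest φ) {ε : ℝ} (hε : 0 < ε) :
    ∃ N c, |expSum N c 0 - φ 0| ≤ ε ∧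
      (∀ t : ℝ≥0, |∫ x : Rpos, φ x ∂(massMeasure (fluxSol t)) -
        ∫ x : Rpos, expSum N c x ∂(massMeasure (fluxSol t))| ≤ ε * t) ∧
      ∀ s, 0 ≤ s → |coagForm constKernel φ (fluxSol s.toNNReal) - coagExpSum N c s| ≤
        3 * ε * s ^ 2 := by
  obtain ⟨C, φ', hC⟩ := hφ.decayBound
  obtain ⟨N, c, d, hd⟩ := hφ.exists_expSum_near hε
  refine ⟨N, c, ?_, fun t => ?_, fun s hs => ?_⟩
  · rw [abs_sub_comm]
    exact hd.abs_le le_rfl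
  · refine (hC.abs_integral_massMeasure_sub_le hd).trans ?_
    gcongr
    exact massMeasure_real_univ_le t.coe_nonneg (massMeasure_fluxSol_univ_le t)
  · rw [← coagForm_expSum_fluxSol N c hs]
    refine (hC.abs_coagForm_sub_le hd (hasMoment_fluxSol _)).trans ?_
    refine mul_le_mul_of_nonneg_left (sq_integral_min_one_le hs ?_) (by positivity)
    have := massMeasure_fluxSol_univ_le s.toNNReal
    rwa [Real.coe_toNNReal s hs] at this

lemma continuousOn_coagForm_fluxSol {φ : ℝ → ℝ} (hφ : IsTest φ) (t : ℝ≥0) :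
    ContinuousOn (fun s : ℝ => coagForm constKernel φ (fluxSol s.toNNReal))
      (Set.uIcc 0 t) := by
  refine continuousOn_of_uniform_approx_of_continuousOn fun u hu => ?_
  obtain ⟨δ, hδ, hu⟩ := Metric.mem_uniformity_dist.1 hu
  -- The added 1 keeps the denominator positive at t = 0 and the final inequality strict.
  have hε : 0 < δ / (3 * (t : ℝ) ^ 2 + 1) := by positivity
  obtain ⟨N, c, -, -, h⟩ := exists_coagForm_near hφ hε
  refine ⟨_, (continuous_coagExpSum N c).continuousOn, fun s hs => hu ?_⟩
  rw [Set.uIcc_of_le t.coe_nonneg] at hs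
  refine (h s hs.1).trans_lt ?_
  have h1 : s ^ 2 ≤ (t : ℝ) ^ 2 := pow_le_pow_left₀ hs.1 hs.2 2
  rw [show 3 * (δ / (3 * (t : ℝ) ^ 2 + 1)) * s ^ 2 = δ * (3 * s ^ 2) / (3 * (t : ℝ) ^ 2 + 1) by
    ring, div_lt_iff₀ (by positivity)]
  nlinarith

lemma fluxSol_equation {φ : ℝ → ℝ} (hφ : IsTest φ) (t : ℝ≥0) :
    ∫ x : Rpos, φ x ∂(massMeasure (fluxSol t)) =
      (∫ s in (0 : ℝ)..t, coagForm constKernel φ (fluxSol s.toNNReal)) + t * φ 0 := by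
  refine eq_of_forall_abs_sub_le (B := t + 3 * (t : ℝ) ^ 2 * t + t) fun ε hε => ?_
  obtain ⟨N, c, h0, h1, h2⟩ := exists_coagForm_near hφ hε
  have ht := t.coe_nonneg
  have h3 : |(∫ s in (0 : ℝ)..t, coagForm constKernel φ (fluxSol s.toNNReal)) -
      ∫ s in (0 : ℝ)..t, coagExpSum N c s| ≤ 3 * ε * (t : ℝ) ^ 2 * t := by
    rw [← intervalIntegral.integral_sub
      ((continuousOn_coagForm_fluxSol hφ t).intervalIntegrable)
      ((continuous_coagExpSum N c).intervalIntegrable _ _)]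
    refine (intervalIntegral.norm_integral_le_of_norm_le_const (C := 3 * ε * (t : ℝ) ^ 2)
      (f := fun s => coagForm constKernel φ (fluxSol s.toNNReal) - coagExpSum N c s)
      fun s hs => ?_).trans_eq (by rw [sub_zero, abs_of_nonneg ht])
    rw [Set.uIoc_of_le ht] at hs
    refine (h2 s hs.1.le).trans ?_
    have := hs.1.le
    have := hs.2
    gcongr
  have h4 := integral_coagExpSum N c t
  have h5 : |t * expSum N c 0 - t * φ 0| ≤ t * ε := by
    rw [← mul_sub, abs_mul, abs_of_nonneg ht]
    gcongr
  have h1 := h1 t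
  rw [abs_le] at h1 h3 h5 ⊢
  constructor <;> nlinarith

lemma isFluxSolution_fluxSol : IsFluxSolution fluxSol where
  radon t := (hasMoment_fluxSol t).isFiniteMeasureOnCompacts
  continuous := continuous_integral_fluxSol
  finite_mass := isFiniteMeasure_massMeasure_fluxSol
  continuous_mass := continuous_integral_massMeasure_fluxSol
  initial := fluxSol_zero
  integrable _ hφ t := (continuousOn_coagForm_fluxSol hφ t).intervalIntegrable
  equation _ hφ t _ := fluxSol_equation hφ t

/-! ### Uniqueness: from the weak equation to the Riccati equation -/

lemma defect_nonpos {φ : ℝ → ℝ} (hφ : Antitone φ) {x y : ℝ} (hx : 0 ≤ x) (hy : 0 ≤ y) :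
    defect φ x y ≤ 0 := by
  have h1 : φ (x + y) ≤ φ x := hφ (by linarith)
  have h2 : φ (x + y) ≤ φ y := hφ (by linarith)
  unfold defect
  nlinarith

lemma coagForm_nonpos {φ : ℝ → ℝ} (hφ : Antitone φ) (μ : Measure Rpos) :
    coagForm constKernel φ μ ≤ 0 := by
  rw [coagForm_constKernel]
  exact integral_nonpos fun p => defect_nonpos hφ p.1.pos.le p.2.pos.le

lemma massLaplace_le_mass {μ : Measure Rpos} [IsFiniteMeasure (massMeasure μ)] {l : ℝ}
    (hl : 0 < l) : massLaplace μ l ≤ (massMeasure μ).real Set.univ := by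
  rw [massMeasure_real_univ]
  refine integral_mono ((hasMoment_of_isFiniteMeasure_massMeasure μ).integrable_mul_exp hl)
    (integrable_size μ) fun x => ?_
  have := x.pos
  exact mul_le_of_le_one_right this.le
    (Real.exp_le_one_iff.2 (by rw [neg_mul, neg_nonpos]; positivity))

lemma bernstein_le_mass {μ : Measure Rpos} [IsFiniteMeasure (massMeasure μ)] {l : ℝ}
    (hl : 0 < l) : bernstein μ l ≤ l * (massMeasure μ).real Set.univ := by
  rw [massMeasure_real_univ, ← integral_const_mul]
  exact integral_mono
    ((hasMoment_of_isFiniteMeasure_massMeasure μ).integrable_one_sub_exp hl.le)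
    ((integrable_size μ).const_mul l) fun x => one_sub_exp_le_mul l x

/-- A positive integrand with zero integral forces the measure to vanish. This covers the degenerate
times when B is recovered as a quotient by B'. -/
lemma bernstein_eq_zero_of_massLaplace_eq_zero {μ : Measure Rpos} (hμ : HasMoment μ) {l : ℝ}
    (hl : 0 < l) (h : massLaplace μ l = 0) : bernstein μ l = 0 := by
  have hpos : ∀ x : Rpos, 0 < (x : ℝ) * Real.exp (-l * x) := fun x =>
    mul_pos x.pos (Real.exp_pos _)
  have h0 := (integral_eq_zero_iff_of_nonneg (fun x => (hpos x).le)
    (hμ.integrable_mul_exp hl)).1 h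
  refine integral_eq_zero_of_ae ?_
  filter_upwards [h0] with x hx
  exact absurd hx (hpos x).ne'

namespace IsFluxSolution

variable {g : ℝ≥0 → Measure Rpos}

lemma hasMoment (hg : IsFluxSolution g) (t : ℝ≥0) : HasMoment (g t) := by
  have := hg.finite_mass t
  exact hasMoment_of_isFiniteMeasure_massMeasure (g t)

/-- Against a nonincreasing cutoff the coagulation term is nonpositive, so only the influx t φ(0) =
t remains; then the cutoff radius tends to infinity. Time 0 is separate, as the equation is assumed
for t > 0 only. -/
lemma massMeasure_univ_le (hg : IsFluxSolution g) (t : ℝ≥0) :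
    massMeasure (g t) Set.univ ≤ ENNReal.ofReal t := by
  rcases eq_or_ne t 0 with rfl | ht
  · simp [hg.initial, massMeasure]
  have ht : 0 < t := pos_of_ne_zero ht
  have hR : ∀ n : ℕ, (0 : ℝ) < (n : ℝ) + 1 := fun n => by positivity
  have hw : ∀ n : ℕ, ∃ C φ', DecayBound C (cutoff ((n : ℝ) + 1)) φ' := fun n =>
    (isTest_cutoff (hR n)).decayBound
  choose C φ' hC using hw
  refine FluxCoagulation.massMeasure_univ_le (w := fun n x => cutoff ((n : ℝ) + 1) x)
    (fun n => (hC n).measurable) (fun n x => cutoff_nonneg _ _) (fun x => ?_)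
    (fun n => (hC n).integrable_mul (hg.hasMoment t)) (fun n => ?_)
  · have h : Continuous fun r : ℝ => max 0 (1 - (x : ℝ) * r) ^ 2 := by fun_prop
    have := (h.tendsto 0).comp (tendsto_one_div_add_atTop_nhds_zero_nat (𝕜 := ℝ))
    simp only [mul_zero, sub_zero, max_eq_right (zero_le_one' ℝ), one_pow] at this
    refine this.congr fun n => ?_
    simp [cutoff, div_eq_mul_inv]
  · rw [← integral_massMeasure (g t) fun x => cutoff ((n : ℝ) + 1) x,
      hg.equation _ (isTest_cutoff (hR n)) t ht, cutoff_zero]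
    have : (∫ s in (0 : ℝ)..t, coagForm constKernel (cutoff ((n : ℝ) + 1)) (g s.toNNReal)) ≤ 0 := by
      rw [intervalIntegral.integral_of_le t.coe_nonneg]
      exact MeasureTheory.integral_nonpos fun s => coagForm_nonpos (cutoff_antitone (hR n)) _
    linarith

lemma massMeasure_real_univ_le (hg : IsFluxSolution g) {s : ℝ} (hs : 0 ≤ s) :
    (massMeasure (g s.toNNReal)).real Set.univ ≤ s := by
  refine FluxCoagulation.massMeasure_real_univ_le hs ?_
  have := hg.massMeasure_univ_le s.toNNReal
  rwa [Real.coe_toNNReal s hs] at this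

lemma massLaplace_le (hg : IsFluxSolution g) {s l : ℝ} (hs : 0 ≤ s) (hl : 0 < l) :
    massLaplace (g s.toNNReal) l ≤ s := by
  have := hg.finite_mass s.toNNReal
  exact (massLaplace_le_mass hl).trans (hg.massMeasure_real_univ_le hs)

lemma bernstein_le (hg : IsFluxSolution g) {s l : ℝ} (hs : 0 ≤ s) (hl : 0 < l) :
    bernstein (g s.toNNReal) l ≤ l * s := by
  have := hg.finite_mass s.toNNReal
  refine (bernstein_le_mass hl).trans ?_
  gcongr
  exact hg.massMeasure_real_univ_le hs

lemma abs_coagForm_add_le (hg : IsFluxSolution g) {s l ε : ℝ} {χ d : ℝ → ℝ} (hs : 0 ≤ s)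
    (hl : 0 < l) (hd : DecayBound ε ((fun x => Real.exp (-l * x)) - χ) d) :
    |coagForm constKernel χ (g s.toNNReal) +
      2 * bernstein (g s.toNNReal) l * massLaplace (g s.toNNReal) l| ≤ 3 * ε * s ^ 2 := by
  have h := (decayBound_exp hl).abs_coagForm_sub_le hd (hg.hasMoment s.toNNReal)
  rw [coagForm_exp (hg.hasMoment _) hl, abs_sub_comm, sub_neg_eq_add] at h
  refine h.trans (mul_le_mul_of_nonneg_left (sq_integral_min_one_le hs ?_)
    (mul_nonneg zero_le_three hd.nonneg))
  have := hg.massMeasure_univ_le s.toNNReal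
  rwa [Real.coe_toNNReal s hs] at this

/-- Measurability in time is assumed only for forms of test functions. It passes to exponentials as
a pointwise limit, and the mass bound gives boundedness. -/
lemma intervalIntegrable_mul (hg : IsFluxSolution g) {l : ℝ} (hl : 0 < l) (t : ℝ≥0) :
    IntervalIntegrable (fun s : ℝ => 2 * bernstein (g s.toNNReal) l *
      massLaplace (g s.toNNReal) l) volume 0 t := by
  have ht := t.coe_nonneg
  have hε : ∀ n : ℕ, (0 : ℝ) < 1 / ((n : ℝ) + 1) := fun n => by positivity
  choose χ hχ _ d hd using fun n : ℕ => exists_test_near_exp hl (hε n)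
  rw [intervalIntegrable_iff_integrableOn_Ioc_of_le ht]
  refine Integrable.of_bound (C := 2 * (l * t) * t) ?_ ?_
  · refine aestronglyMeasurable_of_tendsto_ae atTop
      (f := fun n (s : ℝ) => -coagForm constKernel (χ n) (g s.toNNReal))
      (fun n => ((intervalIntegrable_iff_integrableOn_Ioc_of_le ht).1
        (hg.integrable _ (hχ n) t)).aestronglyMeasurable.neg) ?_
    filter_upwards [self_mem_ae_restrict measurableSet_Ioc] with s hs
    rw [tendsto_iff_norm_sub_tendsto_zero]
    have h0 : Tendsto (fun n : ℕ => 3 * (1 / ((n : ℝ) + 1)) * s ^ 2) atTop (𝓝 (3 * 0 * s ^ 2)) :=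
      (tendsto_one_div_add_atTop_nhds_zero_nat.const_mul 3).mul_const _
    rw [mul_zero, zero_mul] at h0
    refine squeeze_zero (fun n => norm_nonneg _) (fun n => ?_) h0
    rw [Real.norm_eq_abs, ← abs_neg, neg_sub, sub_neg_eq_add, add_comm]
    exact hg.abs_coagForm_add_le hs.1.le hl (hd n)
  · filter_upwards [self_mem_ae_restrict measurableSet_Ioc] with s hs
    have h1 := hg.bernstein_le hs.1.le hl
    have h2 := hg.massLaplace_le hs.1.le hl
    have h3 := bernstein_nonneg (μ := g s.toNNReal) hl.le
    have h4 := massLaplace_nonneg (g s.toNNReal) l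
    have h5 := hs.1.le
    have h6 := hs.2
    rw [Real.norm_of_nonneg (by positivity)]
    have h7 : bernstein (g s.toNNReal) l ≤ l * t := h1.trans (by gcongr)
    have h8 : massLaplace (g s.toNNReal) l ≤ t := h2.trans h6
    gcongr

lemma massLaplace_eq (hg : IsFluxSolution g) {l : ℝ} (hl : 0 < l) (t : ℝ≥0) :
    massLaplace (g t) l =
      t - ∫ s in (0 : ℝ)..t, 2 * bernstein (g s.toNNReal) l * massLaplace (g s.toNNReal) l := by
  rcases eq_or_ne t 0 with rfl | ht
  · simp [hg.initial, massLaplace]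
  have ht0 : 0 < t := pos_of_ne_zero ht
  have ht := t.coe_nonneg
  refine eq_of_forall_abs_sub_le (B := t + 3 * (t : ℝ) ^ 2 * t) fun ε hε => ?_
  obtain ⟨χ, hχ, hχ0, d, hd⟩ := exists_test_near_exp hl hε
  have := hg.finite_mass t
  have h1 := (decayBound_exp hl).abs_integral_massMeasure_sub_le (μ := g t) hd
  have h2 := hg.equation χ hχ t ht0
  rw [hχ0] at h2
  rw [integral_exp_massMeasure] at h1
  have h3 : |(∫ s in (0 : ℝ)..t, coagForm constKernel χ (g s.toNNReal)) +
      ∫ s in (0 : ℝ)..t, 2 * bernstein (g s.toNNReal) l * massLaplace (g s.toNNReal) l| ≤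
      3 * ε * (t : ℝ) ^ 2 * t := by
    rw [← intervalIntegral.integral_add (hg.integrable χ hχ t) (hg.intervalIntegrable_mul hl t)]
    refine (intervalIntegral.norm_integral_le_of_norm_le_const (C := 3 * ε * (t : ℝ) ^ 2)
      (f := fun s => coagForm constKernel χ (g s.toNNReal) +
        2 * bernstein (g s.toNNReal) l * massLaplace (g s.toNNReal) l)
      fun s hs => ?_).trans_eq (by rw [sub_zero, abs_of_nonneg ht])
    rw [Set.uIoc_of_le ht] at hs
    refine (hg.abs_coagForm_add_le hs.1.le hl hd).trans ?_
    have := hs.1.le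
    have := hs.2
    gcongr
  have h4 : ε * (massMeasure (g t)).real Set.univ ≤ ε * t := by
    gcongr
    exact FluxCoagulation.massMeasure_real_univ_le ht (hg.massMeasure_univ_le t)
  rw [abs_le] at h1 h3 ⊢
  constructor <;> nlinarith

lemma continuousOn_massLaplace (hg : IsFluxSolution g) {l : ℝ} (hl : 0 < l) (t : ℝ≥0) :
    ContinuousOn (fun s : ℝ => massLaplace (g s.toNNReal) l) (Set.uIcc 0 t) := by
  refine (continuousOn_id.sub (intervalIntegral.continuousOn_primitive_interval'
    (hg.intervalIntegrable_mul hl t) Set.left_mem_uIcc)).congr fun s hs => ?_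
  rw [Set.uIcc_of_le t.coe_nonneg] at hs
  have := hg.massLaplace_eq hl s.toNNReal
  rwa [Real.coe_toNNReal s hs.1] at this

/-- Only the product 2 B B' is known to be measurable so far, while B' is continuous in time; B is
their quotient, with 0/0 = 0 giving the right value where B' vanishes. -/
lemma aestronglyMeasurable_bernstein (hg : IsFluxSolution g) {l : ℝ} (hl : 0 < l) (t : ℝ≥0) :
    AEStronglyMeasurable (fun s : ℝ => bernstein (g s.toNNReal) l)
      (volume.restrict (Set.uIoc 0 t)) := by
  have h1 := (hg.intervalIntegrable_mul hl t).aestronglyMeasurable_restrict_uIoc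
  have h2 := ((hg.continuousOn_massLaplace hl t).intervalIntegrable
    (μ := volume)).aestronglyMeasurable_restrict_uIoc
  refine (h1.aemeasurable.div (h2.aemeasurable.const_mul 2)).aestronglyMeasurable.congr
    (Eventually.of_forall fun s => ?_)
  simp only [Pi.div_apply]
  by_cases h : massLaplace (g s.toNNReal) l = 0
  · rw [bernstein_eq_zero_of_massLaplace_eq_zero (hg.hasMoment _) hl h, h]
    simp
  · field_simp

lemma bernstein_sq_le (hg : IsFluxSolution g) {l : ℝ} (hl : 0 < l) {s t : ℝ} (hs : 0 ≤ s)
    (hst : s ≤ t) : ‖bernstein (g s.toNNReal) l ^ 2‖ ≤ (l * t) ^ 2 := by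
  rw [Real.norm_of_nonneg (by positivity)]
  refine pow_le_pow_left₀ (bernstein_nonneg hl.le) ((hg.bernstein_le hs hl).trans ?_) 2
  gcongr

lemma intervalIntegrable_bernstein_sq (hg : IsFluxSolution g) {l : ℝ} (hl : 0 < l) (t : ℝ≥0) :
    IntervalIntegrable (fun s : ℝ => bernstein (g s.toNNReal) l ^ 2) volume 0 t := by
  have hm := hg.aestronglyMeasurable_bernstein hl t
  rw [Set.uIoc_of_le t.coe_nonneg] at hm
  rw [intervalIntegrable_iff_integrableOn_Ioc_of_le t.coe_nonneg]
  refine Integrable.of_bound (hm.pow 2) ((l * t) ^ 2) ?_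
  filter_upwards [self_mem_ae_restrict measurableSet_Ioc] with s hs
  exact hg.bernstein_sq_le hl hs.1.le hs.2

lemma hasDerivAt_integral_bernstein_sq (hg : IsFluxSolution g) {l : ℝ} (hl : 0 < l) (t : ℝ≥0) :
    HasDerivAt (fun l => ∫ s in (0 : ℝ)..t, bernstein (g s.toNNReal) l ^ 2)
      (∫ s in (0 : ℝ)..t, 2 * bernstein (g s.toNNReal) l * massLaplace (g s.toNNReal) l) l := by
  refine (intervalIntegral.hasDerivAt_integral_of_dominated_loc_of_deriv_le
    (F := fun l (s : ℝ) => bernstein (g s.toNNReal) l ^ 2)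
    (F' := fun l (s : ℝ) => 2 * bernstein (g s.toNNReal) l * massLaplace (g s.toNNReal) l)
    -- For 0 < k < 2l the mass bound gives B ≤ 2lt and B' ≤ t.
    (bound := fun _ => 2 * (2 * l * t) * t)
    (Ioo_mem_nhds hl (by linarith : l < 2 * l)) ?_ (hg.intervalIntegrable_bernstein_sq hl t)
    (hg.intervalIntegrable_mul hl t).aestronglyMeasurable_restrict_uIoc
    (Eventually.of_forall fun s hs k hk => ?_) intervalIntegrable_const
    (Eventually.of_forall fun s _ k hk => ?_)).2
  · filter_upwards [Ioi_mem_nhds hl] with k hk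
    exact (hg.aestronglyMeasurable_bernstein hk t).pow 2
  · rw [Set.uIoc_of_le t.coe_nonneg] at hs
    have hk0 := hk.1
    have h1 := hg.bernstein_le hs.1.le hk0
    have h2 := hg.massLaplace_le hs.1.le hk0
    have h3 := bernstein_nonneg (μ := g s.toNNReal) hk0.le
    have h4 := massLaplace_nonneg (g s.toNNReal) k
    have h5 := hs.1.le
    have h6 := hs.2
    have h9 := hk.2.le
    rw [Real.norm_of_nonneg (by positivity)]
    have h7 : bernstein (g s.toNNReal) k ≤ 2 * l * t := h1.trans (by gcongr)
    have h8 : massLaplace (g s.toNNReal) k ≤ t := h2.trans h6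
    gcongr
  · refine (((hg.hasMoment s.toNNReal).hasDerivAt_bernstein hk.1).pow 2).congr_deriv ?_
    simp

/-- The Riccati equation for the Bernstein transform, in integrated form. -/
lemma bernstein_eq (hg : IsFluxSolution g) {l : ℝ} (hl : 0 < l) (t : ℝ≥0) :
    bernstein (g t) l = t * l - ∫ s in (0 : ℝ)..t, bernstein (g s.toNNReal) l ^ 2 := by
  have ht := t.coe_nonneg
  have h := eq_zero_of_deriv_eq_zero_of_tendsto (W := fun l => bernstein (g t) l +
    (∫ s in (0 : ℝ)..t, bernstein (g s.toNNReal) l ^ 2) - t * l) (fun l hl => ?_) ?_ hl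
  · linarith
  · refine ((((hg.hasMoment t).hasDerivAt_bernstein hl).add
      (hg.hasDerivAt_integral_bernstein_sq hl t)).sub
        ((hasDerivAt_id l).const_mul (t : ℝ))).congr_deriv ?_
    rw [hg.massLaplace_eq hl t]
    ring
  · have h1 : Tendsto (fun l => ∫ s in (0 : ℝ)..t, bernstein (g s.toNNReal) l ^ 2)
        (𝓝[>] 0) (𝓝 0) := by
      have hc : Continuous fun l : ℝ => (l * t) ^ 2 * |(t : ℝ) - 0| := by fun_prop
      have h0 := (hc.tendsto 0).mono_left (nhdsWithin_le_nhds (s := Set.Ioi 0))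
      simp only [zero_mul, ne_eq, OfNat.ofNat_ne_zero, not_false_eq_true, zero_pow] at h0
      refine squeeze_zero_norm' ?_ h0
      filter_upwards [self_mem_nhdsWithin] with k hk
      refine intervalIntegral.norm_integral_le_of_norm_le_const fun s hs => ?_
      rw [Set.uIoc_of_le ht] at hs
      exact hg.bernstein_sq_le hk hs.1.le hs.2
    have h2 : Tendsto (fun l : ℝ => t * l) (𝓝[>] 0) (𝓝 (t * 0)) :=
      ((continuous_const.mul continuous_id).tendsto 0).mono_left nhdsWithin_le_nhds
    have := ((hg.hasMoment t).tendsto_bernstein_zero.add h1).sub h2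
    simpa using this

/-- Two solutions u, v of the Riccati equation satisfy (u - v)' = -(u - v)(u + v). As both are
nonnegative, (u - v)² is nonincreasing, and it starts at 0. -/
lemma bernstein_eq_tanh (hg : IsFluxSolution g) {l : ℝ} (hl : 0 < l) (t : ℝ≥0) :
    bernstein (g t) l = Real.sqrt l * Real.tanh (Real.sqrt l * t) := by
  set q := Real.sqrt l with hq
  have hq2 : q ^ 2 = l := Real.sq_sqrt hl.le
  have ht := t.coe_nonneg
  set u : ℝ → ℝ := fun s => bernstein (g s.toNNReal) l with hu
  have hint : IntervalIntegrable (fun s => u s ^ 2) volume 0 t :=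
    hg.intervalIntegrable_bernstein_sq hl t
  have hueq : ∀ s, 0 ≤ s → u s = s * l - ∫ r in (0 : ℝ)..s, u r ^ 2 := fun s hs => by
    have := hg.bernstein_eq hl s.toNNReal
    rwa [Real.coe_toNNReal s hs] at this
  -- Bootstrap: the integral equation makes u continuous, so u² is continuous and u is
  -- differentiable.
  have huc : ContinuousOn u (Set.Icc 0 t) := by
    have := intervalIntegral.continuousOn_primitive_interval' hint Set.left_mem_uIcc
    rw [Set.uIcc_of_le ht] at this
    exact ((continuous_id.mul continuous_const).continuousOn.sub this).congr
      fun s hs => hueq s hs.1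
  have hud : ∀ s ∈ Set.Ioo (0 : ℝ) t, HasDerivAt u (l - u s ^ 2) s := fun s hs => by
    have hc2 : ContinuousOn (fun s => u s ^ 2) (Set.Ioo 0 t) :=
      (huc.mono Set.Ioo_subset_Icc_self).pow 2
    have hi : IntervalIntegrable (fun s => u s ^ 2) volume 0 s :=
      hint.mono_set (Set.uIcc_subset_uIcc_left
        (by rw [Set.uIcc_of_le ht]; exact ⟨hs.1.le, hs.2.le⟩))
    have hp := intervalIntegral.integral_hasDerivAt_right hi
      (hc2.stronglyMeasurableAtFilter isOpen_Ioo s hs) (hc2.continuousAt (Ioo_mem_nhds hs.1 hs.2))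
    have h1 : HasDerivAt (fun s : ℝ => s * l) (1 * l) s := (hasDerivAt_id s).mul_const l
    refine ((h1.sub hp).congr_of_eventuallyEq ?_).congr_deriv (by ring)
    filter_upwards [Ioi_mem_nhds hs.1] with r hr using hueq r (le_of_lt hr)
  have hTd : ∀ s, HasDerivAt (fun s => q * Real.tanh (q * s)) (l - (q * Real.tanh (q * s)) ^ 2) s :=
    fun s => by
      have hi : HasDerivAt (fun s : ℝ => q * s) (q * 1) s := (hasDerivAt_id s).const_mul q
      refine (((hasDerivAt_tanh (q * s)).comp s hi).const_mul q).congr_deriv ?_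
      rw [← hq2]
      ring
  have hanti : AntitoneOn (fun s => (u s - q * Real.tanh (q * s)) ^ 2) (Set.Icc 0 t) := by
    refine antitoneOn_of_hasDerivWithinAt_nonpos (convex_Icc _ _)
      (f' := fun s => -(2 * (u s - q * Real.tanh (q * s)) ^ 2 * (u s + q * Real.tanh (q * s))))
      ((huc.sub fun s _ => (hTd s).continuousAt.continuousWithinAt).pow 2)
      (fun s hs => ?_) (fun s hs => ?_)
    · rw [interior_Icc] at hs
      refine (((hud s hs).sub (hTd s)).pow 2).hasDerivWithinAt.congr_deriv ?_
      simp
      ring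
    · rw [interior_Icc] at hs
      have h1 : 0 ≤ u s := bernstein_nonneg hl.le
      have h2 : 0 ≤ q * Real.tanh (q * s) :=
        mul_nonneg (Real.sqrt_nonneg l) (tanh_nonneg (mul_nonneg (Real.sqrt_nonneg l) hs.1.le))
      have := mul_nonneg (mul_nonneg zero_le_two (sq_nonneg (u s - q * Real.tanh (q * s))))
        (add_nonneg h1 h2)
      linarith
  have h := hanti ⟨le_rfl, ht⟩ ⟨ht, le_rfl⟩ ht
  have h0 : u 0 = 0 := by simpa using hueq 0 le_rfl
  simp only [h0, mul_zero, Real.tanh_zero, sub_zero, ne_eq, OfNat.ofNat_ne_zero,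
    not_false_eq_true, zero_pow] at h
  have h3 := pow_eq_zero_iff (two_ne_zero) |>.1 (le_antisymm h (sq_nonneg _))
  have h4 : u t = bernstein (g t) l := by simp [hu]
  linarith

lemma eq_fluxSol (hg : IsFluxSolution g) : g = fluxSol := by
  ext1 t
  exact (hg.hasMoment t).ext_of_bernstein (hasMoment_fluxSol t) fun l hl => by
    rw [hg.bernstein_eq_tanh hl, bernstein_fluxSol t hl]

end IsFluxSolution

/-! ### The stationary power law and its flux -/

lemma powerLaw_eq (c : ℝ) : powerLaw c =
    lebesguePos.withDensity fun x => ENNReal.ofReal (c * (x : ℝ) ^ (-(3 / 2) : ℝ)) := rfl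

lemma measurable_powerLaw_density (c : ℝ) :
    Measurable fun x : Rpos => ENNReal.ofReal (c * (x : ℝ) ^ (-(3 / 2) : ℝ)) := by
  fun_prop

lemma lintegral_powerLaw (c : ℝ) {f : ℝ → ℝ≥0∞} (hf : Measurable f) :
    ∫⁻ x : Rpos, f x ∂(powerLaw c) =
      ∫⁻ x in Set.Ioi (0 : ℝ), ENNReal.ofReal (c * x ^ (-(3 / 2) : ℝ)) * f x := by
  have hf' : Measurable fun x : Rpos => f x := hf.comp measurable_subtype_coe
  rw [powerLaw_eq, lintegral_withDensity_eq_lintegral_mul _ (measurable_powerLaw_density c) hf']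
  exact lintegral_lebesguePos fun x => ENNReal.ofReal (c * x ^ (-(3 / 2) : ℝ)) * f x

lemma integral_powerLaw {c : ℝ} (hc : 0 ≤ c) (f : ℝ → ℝ) :
    ∫ x : Rpos, f x ∂(powerLaw c) = ∫ x in Set.Ioi (0 : ℝ), c * x ^ (-(3 / 2) : ℝ) * f x := by
  rw [powerLaw_eq, integral_withDensity_ofReal (by fun_prop)
    fun x => mul_nonneg hc (Real.rpow_nonneg x.pos.le _)]
  exact integral_subtype_comap measurableSet_Ioi fun x : ℝ => c * x ^ (-(3 / 2) : ℝ) * f x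

lemma rpow_mul_self {x : ℝ} (hx : 0 < x) :
    x ^ (-(3 / 2) : ℝ) * x = x ^ ((1 / 2 : ℝ) - 1) := by
  nth_rewrite 2 [← Real.rpow_one x]
  rw [← Real.rpow_add hx]
  norm_num

lemma hasMoment_powerLaw {c : ℝ} (hc : 0 ≤ c) : HasMoment (powerLaw c) := by
  refine (lintegral_ofReal_ne_top_iff_integrable (by fun_prop)
    (Eventually.of_forall fun x => (min_one_pos x).le)).1 ?_
  rw [lintegral_powerLaw c (f := fun x => ENNReal.ofReal (min 1 x)) (by fun_prop)]
  have hi : IntegrableOn (fun x : ℝ => c * x ^ (-(3 / 2) : ℝ) * min 1 x) (Set.Ioi 0) := by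
    rw [← Set.Ioc_union_Ioi_eq_Ioi zero_le_one]
    refine IntegrableOn.union ?_ ?_
    · have h := (intervalIntegrable_iff_integrableOn_Ioc_of_le zero_le_one).1
        (intervalIntegral.intervalIntegrable_rpow' (a := 0) (b := 1)
          (by norm_num : (-1 : ℝ) < (1 / 2 : ℝ) - 1))
      refine IntegrableOn.congr_fun (h.const_mul c) (fun x hx => ?_) measurableSet_Ioc
      rw [min_eq_right hx.2, mul_assoc, rpow_mul_self hx.1]
    · have h := integrableOn_Ioi_rpow_of_lt (by norm_num : (-(3 / 2) : ℝ) < -1) one_pos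
      refine IntegrableOn.congr_fun (h.const_mul c) (fun x hx => ?_) measurableSet_Ioi
      rw [min_eq_left (le_of_lt hx), mul_one]
  refine ne_of_eq_of_ne (setLIntegral_congr_fun measurableSet_Ioi fun x hx => ?_)
    hi.lintegral_lt_top.ne
  have hx : (0 : ℝ) < x := hx
  exact (ENNReal.ofReal_mul (by positivity)).symm

/-- The constant of the stationary power law. -/
def stationaryConst : ℝ := 1 / (2 * Real.sqrt Real.pi)

lemma stationaryConst_pos : 0 < stationaryConst := by
  have := Real.pi_pos
  unfold stationaryConst
  positivity

lemma massLaplace_powerLaw {l : ℝ} (hl : 0 < l) :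
    massLaplace (powerLaw stationaryConst) l = 1 / (2 * Real.sqrt l) := by
  rw [massLaplace, integral_powerLaw stationaryConst_pos.le fun x => x * Real.exp (-l * x)]
  have h := Real.integral_rpow_mul_exp_neg_mul_Ioi (by norm_num : (0 : ℝ) < 1 / 2) hl
  have h1 : ∫ x in Set.Ioi (0 : ℝ), stationaryConst * x ^ (-(3 / 2) : ℝ) *
      (x * Real.exp (-l * x)) =
      ∫ x in Set.Ioi (0 : ℝ), stationaryConst * (x ^ ((1 / 2 : ℝ) - 1) * Real.exp (-(l * x))) := by
    refine setIntegral_congr_fun measurableSet_Ioi fun x hx => ?_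
    rw [← rpow_mul_self hx, neg_mul]
    ring
  have hpi := Real.pi_pos
  rw [h1, integral_const_mul, h, Real.Gamma_one_half_eq, ← Real.sqrt_eq_rpow, stationaryConst,
    Real.sqrt_div zero_le_one, Real.sqrt_one]
  field_simp

/-- Only derivatives are compared: B' is a Gamma integral with value 1/(2√l), and both sides vanish
at 0+. -/
lemma bernstein_powerLaw {l : ℝ} (hl : 0 < l) :
    bernstein (powerLaw stationaryConst) l = Real.sqrt l := by
  have hm := hasMoment_powerLaw stationaryConst_pos.le
  have h := eq_zero_of_deriv_eq_zero_of_tendsto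
    (W := fun l => bernstein (powerLaw stationaryConst) l - Real.sqrt l) (fun l hl => ?_) ?_ hl
  · linarith
  · refine ((hm.hasDerivAt_bernstein hl).sub (Real.hasDerivAt_sqrt hl.ne')).congr_deriv ?_
    rw [massLaplace_powerLaw hl, sub_self]
  · have := hm.tendsto_bernstein_zero.sub
      ((Real.continuous_sqrt.tendsto 0).mono_left (nhdsWithin_le_nhds (s := Set.Ioi 0)))
    simpa using this

lemma isStationarySolution_powerLaw : IsStationarySolution (powerLaw stationaryConst) where
  radon := (hasMoment_powerLaw stationaryConst_pos.le).isFiniteMeasureOnCompacts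
  moment := hasMoment_powerLaw stationaryConst_pos.le
  equation _ hφ := (hasMoment_powerLaw stationaryConst_pos.le).stationary_of_exp
    (fun l hl => by
      have : 0 < Real.sqrt l := Real.sqrt_pos.2 hl
      rw [bernstein_powerLaw hl, massLaplace_powerLaw hl]
      field_simp) hφ

lemma isStationarySolution_iff (μ : Measure Rpos) :
    IsStationarySolution μ ↔ μ = powerLaw stationaryConst := by
  refine ⟨fun h => ?_, fun h => h ▸ isStationarySolution_powerLaw⟩
  have hm : HasMoment μ := h.moment
  exact hm.ext_of_bernstein (hasMoment_powerLaw stationaryConst_pos.le) fun l hl => by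
    rw [h.bernstein_eq hl, bernstein_powerLaw hl]

lemma powerLaw_tail {c : ℝ} (hc : 0 ≤ c) {r : ℝ} (hr : 0 < r) :
    powerLaw c {y | r < (y : ℝ)} = ENNReal.ofReal (2 * c * (Real.sqrt r)⁻¹) := by
  have hS : MeasurableSet {y : Rpos | r < (y : ℝ)} :=
    measurableSet_lt measurable_const measurable_subtype_coe
  rw [← lintegral_indicator_one hS]
  have h1 : ∀ y : Rpos, {y : Rpos | r < (y : ℝ)}.indicator (1 : Rpos → ℝ≥0∞) y =
      (Set.Ioi r).indicator (1 : ℝ → ℝ≥0∞) y := fun y => rfl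
  rw [lintegral_congr h1, lintegral_powerLaw c (measurable_one.indicator measurableSet_Ioi)]
  have h2 : ∀ x : ℝ, ENNReal.ofReal (c * x ^ (-(3 / 2) : ℝ)) *
      (Set.Ioi r).indicator (1 : ℝ → ℝ≥0∞) x =
      (Set.Ioi r).indicator (fun x => ENNReal.ofReal (c * x ^ (-(3 / 2) : ℝ))) x := fun x => by
    by_cases hx : x ∈ Set.Ioi r <;> simp [hx]
  rw [lintegral_congr h2, setLIntegral_indicator measurableSet_Ioi,
    Set.inter_eq_left.2 (Set.Ioi_subset_Ioi hr.le)]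
  have ha : (-(3 / 2) : ℝ) < -1 := by norm_num
  rw [← ofReal_integral_eq_lintegral_ofReal
    ((integrableOn_Ioi_rpow_of_lt ha hr).const_mul c), integral_const_mul,
    integral_Ioi_rpow_of_lt ha hr]
  · congr 1
    rw [show (-(3 / 2) : ℝ) + 1 = -(1 / 2) by norm_num, Real.rpow_neg hr.le, ← Real.sqrt_eq_rpow]
    ring
  · filter_upwards [self_mem_ae_restrict measurableSet_Ioi] with x hx
    have : 0 < x := hr.trans hx
    positivity

/-- The function arcsin(2x/z - 1) is a primitive, rising from -π/2 to π/2. Integrability at the two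
singular endpoints follows from its continuity and the sign of the derivative. -/
lemma lintegral_arcsine {z : ℝ} (hz : 0 < z) :
    ∫⁻ x in Set.Ioc 0 z, ENNReal.ofReal ((Real.sqrt x)⁻¹ * (Real.sqrt (z - x))⁻¹) =
      ENNReal.ofReal Real.pi := by
  have hc : ContinuousOn (fun x => Real.arcsin (2 * x / z - 1)) (Set.Icc 0 z) :=
    (Real.continuous_arcsin.comp (by fun_prop)).continuousOn
  have hd : ∀ x ∈ Set.Ioo 0 z, HasDerivAt (fun x => Real.arcsin (2 * x / z - 1))
      ((Real.sqrt x)⁻¹ * (Real.sqrt (z - x))⁻¹) x := fun x hx => by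
    have h0 := hx.1
    have h1 : 0 < z - x := sub_pos.2 hx.2
    have hi : HasDerivAt (fun x : ℝ => 2 * x / z - 1) (2 * 1 / z) x :=
      (((hasDerivAt_id x).const_mul 2).div_const z).sub_const 1
    have hn1 : 2 * x / z - 1 ≠ -1 := by
      have : 0 < 2 * x / z := by positivity
      linarith
    have hn2 : 2 * x / z - 1 ≠ 1 := by
      have : 2 * x / z < 2 := by rw [div_lt_iff₀ hz]; linarith [hx.2]
      linarith
    have hs : Real.sqrt (1 - (2 * x / z - 1) ^ 2) = 2 / z * (Real.sqrt x * Real.sqrt (z - x)) := by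
      rw [Real.sqrt_eq_iff_mul_self_eq_of_pos (by positivity)]
      have a1 := Real.mul_self_sqrt h0.le
      have a2 := Real.mul_self_sqrt h1.le
      calc 2 / z * (Real.sqrt x * Real.sqrt (z - x)) * (2 / z * (Real.sqrt x * Real.sqrt (z - x)))
          = 4 / z ^ 2 * (Real.sqrt x * Real.sqrt x) * (Real.sqrt (z - x) * Real.sqrt (z - x)) := by
            ring
        _ = 1 - (2 * x / z - 1) ^ 2 := by
            rw [a1, a2]
            field_simp
            ring
    refine ((Real.hasDerivAt_arcsin hn1 hn2).comp x hi).congr_deriv ?_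
    rw [hs]
    have := Real.sqrt_pos.2 h0
    have := Real.sqrt_pos.2 h1
    field_simp
  have hnn : ∀ x, 0 ≤ (Real.sqrt x)⁻¹ * (Real.sqrt (z - x))⁻¹ := fun x => by positivity
  have hi := intervalIntegral.integrableOn_deriv_of_nonneg hc hd fun x _ => hnn x
  rw [← ofReal_integral_eq_lintegral_ofReal hi (Eventually.of_forall hnn),
    ← intervalIntegral.integral_of_le hz.le,
    intervalIntegral.integral_eq_sub_of_hasDerivAt_of_le hz.le hc hd
      ((intervalIntegrable_iff_integrableOn_Ioc_of_le hz.le).2 hi)]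
  congr 1
  rw [mul_div_assoc, div_self hz.ne']
  norm_num

/-- The stationary power law has constant mass flux. -/
lemma massFlux_powerLaw {z : ℝ} (hz : 0 < z) :
    massFlux constKernel (powerLaw stationaryConst) z = 1 := by
  set c := stationaryConst with hc
  have hc0 : 0 < c := stationaryConst_pos
  have := (hasMoment_powerLaw hc0.le).sigmaFinite
  have h1 : Measurable fun p : Rpos × Rpos => (p.1 : ℝ) := by fun_prop
  have h2 : Measurable fun p : Rpos × Rpos => (p.2 : ℝ) := by fun_prop
  have hS : MeasurableSet {p : Rpos × Rpos | (p.1 : ℝ) ≤ z ∧ z - p.1 < p.2} :=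
    (measurableSet_le h1 measurable_const).inter (measurableSet_lt (h1.const_sub z) h2)
  have hm : Measurable fun p : Rpos × Rpos =>
      ENNReal.ofReal ((p.1 : ℝ) * constKernel p.1 p.2) := by
    unfold constKernel
    fun_prop
  rw [massFlux, ← lintegral_indicator hS,
    lintegral_prod _ (hm.indicator hS).aemeasurable]
  set F : ℝ → ℝ≥0∞ := (Set.Iio z).indicator fun x =>
    ENNReal.ofReal (x * 2) * ENNReal.ofReal (2 * c * (Real.sqrt (z - x))⁻¹) with hF
  have hFm : Measurable F := Measurable.indicator (by fun_prop) measurableSet_Iio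
  have hinner : ∀ x : Rpos, (x : ℝ) ≠ z →
      ∫⁻ y, {p : Rpos × Rpos | (p.1 : ℝ) ≤ z ∧ z - p.1 < p.2}.indicator
        (fun p => ENNReal.ofReal ((p.1 : ℝ) * constKernel p.1 p.2)) (x, y) ∂(powerLaw c) =
      F x := fun x hx => by
    have hT : MeasurableSet {y : Rpos | z - x < (y : ℝ)} :=
      measurableSet_lt measurable_const measurable_subtype_coe
    rcases lt_or_gt_of_ne hx with h | h
    · rw [hF, Set.indicator_of_mem (Set.mem_Iio.2 h), ← powerLaw_tail hc0.le (sub_pos.2 h),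
        ← lintegral_indicator_one hT, ← lintegral_const_mul _ (measurable_one.indicator hT)]
      refine lintegral_congr fun y => ?_
      by_cases h2 : z - (x : ℝ) < y <;> simp [Set.indicator, constKernel, h.le, h2]
    · rw [hF, Set.indicator_of_notMem (by simpa using h.le)]
      refine (lintegral_congr fun y => ?_).trans lintegral_zero
      exact Set.indicator_of_notMem (fun hy => absurd hy.1 (not_le.2 h)) _
  -- At x = z the inner integral runs over all y > 0, where the power law has infinite mass; this
  -- single point is null.
  have hne : ∀ᵐ x : Rpos ∂(powerLaw c), (x : ℝ) ≠ z := by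
    have hac : powerLaw c ≪ lebesguePos := withDensity_absolutelyContinuous _ _
    refine hac.ae_le (measure_eq_zero_iff_ae_notMem (s := {(⟨z, hz⟩ : Rpos)}) |>.1 ?_ |>.mono
      fun x hx h => hx (Subtype.ext h))
    rw [lebesguePos, comap_subtype_coe_apply measurableSet_Ioi, Set.image_singleton,
      Real.volume_singleton]
  rw [lintegral_congr_ae (hne.mono hinner), lintegral_powerLaw c hFm]
  have hpi := Real.pi_pos
  -- The factor 4c² collects the kernel 2, the tail constant 2c and the outer density c; it cancels
  -- the arcsine integral π.
  have hcc : 4 * (c * c) = 1 / Real.pi := by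
    have h := Real.mul_self_sqrt hpi.le
    have hs := Real.sqrt_pos.2 hpi
    rw [hc, stationaryConst]
    set q := Real.sqrt Real.pi
    rw [← h]
    field_simp
    norm_num
  have hpt : ∀ x ∈ Set.Ioi (0 : ℝ), ENNReal.ofReal (c * x ^ (-(3 / 2) : ℝ)) * F x =
      (Set.Iio z).indicator (fun x => ENNReal.ofReal (1 / Real.pi) *
        ENNReal.ofReal ((Real.sqrt x)⁻¹ * (Real.sqrt (z - x))⁻¹)) x := fun x hx => by
    have hx : 0 < x := hx
    by_cases h : x ∈ Set.Iio z
    · rw [hF, Set.indicator_of_mem h, Set.indicator_of_mem h, ← ENNReal.ofReal_mul (by positivity),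
        ← ENNReal.ofReal_mul (by positivity), ← ENNReal.ofReal_mul (by positivity), ← hcc]
      have h1 : x ^ (-(3 / 2) : ℝ) * x = (Real.sqrt x)⁻¹ := by
        rw [rpow_mul_self hx, show (1 / 2 : ℝ) - 1 = -(1 / 2) by norm_num, Real.rpow_neg hx.le,
          Real.sqrt_eq_rpow]
      rw [← h1]
      congr 1
      ring
    · rw [hF, Set.indicator_of_notMem h, Set.indicator_of_notMem h, mul_zero]
  rw [setLIntegral_congr_fun measurableSet_Ioi hpt, setLIntegral_indicator measurableSet_Iio,
    Set.Iio_inter_Ioi, setLIntegral_congr Ioo_ae_eq_Ioc, lintegral_const_mul _ (by fun_prop),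
    lintegral_arcsine hz, ← ENNReal.ofReal_mul (by positivity), one_div,
    inv_mul_cancel₀ hpi.ne', ENNReal.ofReal_one]

/-! ### Convergence to the stationary solution -/

lemma tendsto_integral_fluxSol (φ : C_c(Rpos, ℝ)) :
    Tendsto (fun t : ℝ≥0 => ∫ x, φ x ∂(fluxSol t)) atTop
      (𝓝 (∫ x, φ x ∂(powerLaw stationaryConst))) := by
  refine tendsto_integral_of_tendsto_bernstein hasMoment_fluxSol
    (hasMoment_powerLaw stationaryConst_pos.le) (fun l hl => ?_) φ
  have hs : 0 < Real.sqrt l := Real.sqrt_pos.2 hl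
  simp only [bernstein_fluxSol _ hl, bernstein_powerLaw hl]
  have h : Tendsto (fun t : ℝ≥0 => Real.sqrt l * (t : ℝ)) atTop atTop :=
    (NNReal.tendsto_coe_atTop.2 tendsto_id).const_mul_atTop hs
  simpa using (tendsto_tanh_atTop.comp h).const_mul (Real.sqrt l)

end FluxCoagulation

end

theorem mainTheorem3 :
    ∃ f : ℝ≥0 → Measure FluxCoagulation.Rpos,
      FluxCoagulation.IsFluxSolution f ∧
      (∀ g : ℝ≥0 → Measure FluxCoagulation.Rpos, FluxCoagulation.IsFluxSolution g → g = f) ∧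
      (∀ t : ℝ≥0, Integrable (fun x : FluxCoagulation.Rpos => min 1 (x : ℝ)) (f t)) ∧
      (∀ (t : ℝ≥0) (l : ℝ), 0 < l →
        FluxCoagulation.bernstein (f t) l = Real.sqrt l * Real.tanh (Real.sqrt l * t)) ∧
      (∀ μ : Measure FluxCoagulation.Rpos, FluxCoagulation.IsStationarySolution μ ↔
        μ = FluxCoagulation.powerLaw (1 / (2 * Real.sqrt Real.pi))) ∧
      (∀ z : ℝ, 0 < z →
        FluxCoagulation.massFlux FluxCoagulation.constKernel
          (FluxCoagulation.powerLaw (1 / (2 * Real.sqrt Real.pi))) z = 1) ∧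
      (∀ φ : C_c(FluxCoagulation.Rpos, ℝ),
        Tendsto (fun t : ℝ≥0 => ∫ x, φ x ∂(f t)) atTop
          (𝓝 (∫ x, φ x ∂(FluxCoagulation.powerLaw (1 / (2 * Real.sqrt Real.pi)))))) :=
  ⟨FluxCoagulation.fluxSol, FluxCoagulation.isFluxSolution_fluxSol,
    fun _ hg => hg.eq_fluxSol, FluxCoagulation.hasMoment_fluxSol,
    fun t _ hl => FluxCoagulation.bernstein_fluxSol t hl,
    FluxCoagulation.isStationarySolution_iff, fun _ hz => FluxCoagulation.massFlux_powerLaw hz,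
    FluxCoagulation.tendsto_integral_fluxSol⟩
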